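/- Let $\mathbb{N}=\{1,2,3,\dots\}$ and let $\mathcal{S}=\{F\subset\mathbb{N} \text{ finite}: F=\emptyset \text{ or } |F|\le \min F\}$ be the Schreier family. For every countable limit ordinal $\lambda$ fix an increasing (not necessarily strictly) sequence $(\lambda_n)_{n\in\mathbb{N}}$ of ordinals with $1\le\lambda_n<\lambda$ converging to $\lambda$. Define $\mathcal{S}_\alpha$ for $1\le\alpha<\omega_1$ by $\mathcal{S}_1=\mathcal{S}$; $$\mathcal{S}_{\alpha+1}=\Big\{\bigcup_{j=1}^kE_j:\ \emptyset\ne E_j\in\mathcal{S}_\alpha,\ E_1<E_2<\dots<E_k,\ \{\min E_j:1\le j\le k\}\in\mathcal{S}\Big\}\cup\{\emptyset\},$$ where $E<E'$ means $x<y$ for all $x\in E$, $y\in E'$; and, for $\lambda$ a limit ordinal, $\mathcal{S}_\lambda=\{F\subset\mathbb{N}\text{ finite}: F\in\mathcal{S}_{\lambda_n}\text{ for some } n\le\min F\}\cup\{\emptyset\}$. Let $\mathbb{K}=\mathbb{R}$ or $\mathbb{K}=\mathbb{C}$. For $1\le\alpha<\omega_1$ let $X_{\mathcal{S}_\alpha}$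 be the completion of the space $c_{00}$ of finitely supported sequences $x=(x(i))_{i\in\mathbb{N}}$ in $\mathbb{K}$ under the norm $\|x\|=\sup\{\sum_{i\in F}|x(i)|: F\in\mathcal{S}_\alpha\}$, and let $e_i^*\in X_{\mathcal{S}_\alpha}^*$ be the continuous extension of the coordinate functional $x\mapsto x(i)$. **Theorem.** Let $1\le\alpha<\omega_1$ and let $T:X_{\mathcal{S}_\alpha}^*\to X_{\mathcal{S}_\alpha}^*$ be a surjective $\mathbb{K}$-linear isometry. Then there are scalars $\theta_i\in\mathbb{K}$ with $|\theta_i|=1$ $(i\in\mathbb{N})$ such that $Te_i^*=\theta_ie_i^*$ for every $i\in\mathbb{N}$. -/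

import Mathlib

open scoped Ordinal

/-! Throughout, `ℕ+ = {1, 2, 3, …}` is the index set of the basis. -/

/-! ### Schreier families -/

/-- The Schreier family: finite `F ⊆ {1, 2, …}` with `F = ∅` or `|F| ≤ min F`. The inequality is
written elementwise, `|F| ≤ i` for all `i ∈ F`; this includes `F = ∅`. -/
def schreier : Set (Finset ℕ+) :=
  {F | ∀ i ∈ F, F.card ≤ (i : ℕ)}

/-- The successor step: all unions `E₁ ∪ … ∪ E_k` of nonempty successive sets `E₁ < … < E_k`
in `S` for which `{min E₁, …, min E_k}` is in the Schreier family. (`k = 0` gives `∅`.) -/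
def schreierSucc (S : Set (Finset ℕ+)) : Set (Finset ℕ+) :=
  {F | ∃ (k : ℕ) (E : Fin k → Finset ℕ+) (hne : ∀ j, (E j).Nonempty),
    (∀ j, E j ∈ S) ∧
    (∀ i j, i < j → ∀ x ∈ E i, ∀ y ∈ E j, x < y) ∧
    (Finset.univ.image fun j => (E j).min' (hne j)) ∈ schreier ∧
    F = Finset.univ.biUnion E}

/-- `a` fixes, for every countable limit ordinal `l`, an increasing sequence
`a l 1 ≤ a l 2 ≤ …` of ordinals in `[1, l)` that converges to `l`. -/
def IsLimitSystem (a : Ordinal.{0} → ℕ+ → Ordinal.{0}) : Prop :=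
  ∀ l : Ordinal.{0}, Order.IsSuccLimit l → l < ω₁ →
    Monotone (a l) ∧ (∀ n, 1 ≤ a l n ∧ a l n < l) ∧ IsLUB (Set.range (a l)) l

/-- The Schreier family `S_α`, `α ≥ 1`, built with the sequences `a`, by transfinite recursion
(the value at `α = 0` is a dummy). The three defining clauses are spelled out in
`schreierFamily_one`, `schreierFamily_add_one` and `schreierFamily_limit`. -/
noncomputable def schreierFamily (a : Ordinal.{0} → ℕ+ → Ordinal.{0}) (α : Ordinal.{0}) :
    Set (Finset ℕ+) :=
  Ordinal.limitRecOn (motive := fun _ => Set (Finset ℕ+)) α ∅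
    (fun β S => {F | (β = 0 ∧ F ∈ schreier) ∨ (β ≠ 0 ∧ F ∈ schreierSucc S)})
    (fun l _ S => {F | ∃ (n : ℕ+) (h : a l n < l), F ∈ S (a l n) h ∧ ∀ i ∈ F, n ≤ i})

theorem schreierFamily_one (a : Ordinal.{0} → ℕ+ → Ordinal.{0}) :
    schreierFamily a 1 = schreier := by
  have h : schreierFamily a (0 + 1) = schreier := by
    unfold schreierFamily
    rw [Ordinal.limitRecOn_add_one]
    simp
  rwa [zero_add] at h

theorem schreierFamily_add_one (a : Ordinal.{0} → ℕ+ → Ordinal.{0}) {β : Ordinal.{0}}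
    (hβ : 1 ≤ β) : schreierFamily a (β + 1) = schreierSucc (schreierFamily a β) := by
  have h0 : β ≠ 0 := Order.one_le_iff_ne_zero.mp hβ
  unfold schreierFamily
  rw [Ordinal.limitRecOn_add_one]
  simp [h0]

/-- For a limit ordinal `l`: `F ∈ S_l` iff `F ∈ S_{a l n}` for some `n ≤ min F` (or `F = ∅`). -/
theorem schreierFamily_limit {a : Ordinal.{0} → ℕ+ → Ordinal.{0}} (ha : IsLimitSystem a)
    {l : Ordinal.{0}} (hl : Order.IsSuccLimit l) (hl' : l < ω₁) :
    schreierFamily a l =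
      {F | ∃ n : ℕ+, F ∈ schreierFamily a (a l n) ∧ ∀ i ∈ F, n ≤ i} := by
  have h : schreierFamily a l =
      {F | ∃ (n : ℕ+) (_ : a l n < l), F ∈ schreierFamily a (a l n) ∧ ∀ i ∈ F, n ≤ i} := by
    unfold schreierFamily
    rw [Ordinal.limitRecOn_limit _ _ _ _ hl]
  rw [h]
  ext F
  simp only [Set.mem_ofPred_eq]
  constructor
  · rintro ⟨n, -, h⟩
    exact ⟨n, h⟩
  · rintro ⟨n, h⟩
    exact ⟨n, ((ha l hl hl').2.1 n).2, h⟩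

/-- Schreier families contain all singletons. -/
theorem schreierFamily_singleton_mem {a : Ordinal.{0} → ℕ+ → Ordinal.{0}} (ha : IsLimitSystem a)
    {α : Ordinal.{0}} (h1 : 1 ≤ α) (hα : α < ω₁) (i : ℕ+) : {i} ∈ schreierFamily a α := by
  induction α using Ordinal.limitRecOn with
  | zero => simp at h1
  | add_one β ih =>
    rcases eq_or_ne β 0 with rfl | hβ
    · rw [zero_add, schreierFamily_one]
      intro j _
      exact (Finset.card_singleton i).trans_le j.pos
    · have hβ1 : 1 ≤ β := Order.one_le_iff_ne_zero.mpr hβ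
      have hβω : β < ω₁ := lt_of_le_of_lt (le_of_lt (Order.lt_add_one_iff.mpr le_rfl)) hα
      rw [schreierFamily_add_one a hβ1]
      refine ⟨1, fun _ => {i}, fun _ => Finset.singleton_nonempty i, fun _ => ih hβ1 hβω,
        ?_, ?_, ?_⟩
      · intro p q hpq
        exact absurd (Subsingleton.elim p q) hpq.ne
      · intro j _
        exact (Finset.card_image_le.trans (by simp)).trans j.pos
      · simp
  | limit l hl ih =>
    rw [schreierFamily_limit ha hl hα]
    obtain ⟨h, h'⟩ := (ha l hl hα).2.1 1
    exact ⟨1, ih _ h' h (h'.trans hα), fun j _ => one_le⟩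

/-! ### Combinatorial Banach spaces -/

/-- `c₀₀`, the finitely supported scalar sequences, to be normed by the family `𝓕`. -/
def CombPre (𝕜 : Type*) [RCLike 𝕜] (_𝓕 : Set (Finset ℕ+)) : Type _ := ℕ+ →₀ 𝕜

namespace CombPre

variable {𝕜 : Type*} [RCLike 𝕜] {𝓕 : Set (Finset ℕ+)}

noncomputable instance : AddCommGroup (CombPre 𝕜 𝓕) := inferInstanceAs (AddCommGroup (ℕ+ →₀ 𝕜))

noncomputable instance : Module 𝕜 (CombPre 𝕜 𝓕) := inferInstanceAs (Module 𝕜 (ℕ+ →₀ 𝕜))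

/-- The `i`-th coordinate. -/
noncomputable def coord (i : ℕ+) : CombPre 𝕜 𝓕 →ₗ[𝕜] 𝕜 := Finsupp.lapply (M := 𝕜) i

/-- `‖x‖ = sup {∑_{i ∈ F} |x(i)| : F ∈ 𝓕}`. -/
noncomputable instance : Norm (CombPre 𝕜 𝓕) where
  norm x := ⨆ F : 𝓕, ∑ i ∈ F.1, ‖coord i x‖

theorem norm_def (x : CombPre 𝕜 𝓕) : ‖x‖ = ⨆ F : 𝓕, ∑ i ∈ F.1, ‖coord i x‖ := rfl

theorem bddAbove_sums (x : CombPre 𝕜 𝓕) :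
    BddAbove (Set.range fun F : 𝓕 => ∑ i ∈ F.1, ‖coord i x‖) := by
  classical
  refine ⟨∑ i ∈ Finsupp.support (M := 𝕜) x, ‖coord i x‖, ?_⟩
  rintro _ ⟨F, rfl⟩
  have h : ∑ i ∈ F.1 ∩ Finsupp.support (M := 𝕜) x, ‖coord i x‖ = ∑ i ∈ F.1, ‖coord i x‖ := by
    refine Finset.sum_subset Finset.inter_subset_left fun i hi hi' => ?_
    have hx : i ∉ Finsupp.support (M := 𝕜) x := fun h => hi' (Finset.mem_inter.mpr ⟨hi, h⟩)
    have h0 : coord i x = 0 := Finsupp.notMem_support_iff.mp hx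
    rw [h0, norm_zero]
  change ∑ i ∈ F.1, ‖coord i x‖ ≤ _
  rw [← h]
  exact Finset.sum_le_sum_of_subset_of_nonneg Finset.inter_subset_right
    fun i _ _ => norm_nonneg _

theorem sum_le_norm (x : CombPre 𝕜 𝓕) {F : Finset ℕ+} (hF : F ∈ 𝓕) :
    ∑ i ∈ F, ‖coord i x‖ ≤ ‖x‖ :=
  le_ciSup (bddAbove_sums x) (⟨F, hF⟩ : 𝓕)

theorem seminormedSpaceCore : SeminormedSpace.Core 𝕜 (CombPre 𝕜 𝓕) where
  norm_nonneg x := Real.iSup_nonneg fun F => Finset.sum_nonneg fun i _ => norm_nonneg _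
  norm_smul c x := by
    simp only [norm_def, map_smul, smul_eq_mul, norm_mul, ← Finset.mul_sum]
    exact (Real.mul_iSup_of_nonneg (norm_nonneg c) _).symm
  norm_triangle x y := by
    refine Real.iSup_le (fun F => ?_) (add_nonneg
      (Real.iSup_nonneg fun F => Finset.sum_nonneg fun i _ => norm_nonneg _)
      (Real.iSup_nonneg fun F => Finset.sum_nonneg fun i _ => norm_nonneg _))
    calc ∑ i ∈ F.1, ‖coord i (x + y)‖
        ≤ ∑ i ∈ F.1, (‖coord i x‖ + ‖coord i y‖) := by
          refine Finset.sum_le_sum fun i _ => ?_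
          rw [map_add]
          exact norm_add_le _ _
      _ ≤ ‖x‖ + ‖y‖ := by
          rw [Finset.sum_add_distrib]
          exact add_le_add (sum_le_norm x F.2) (sum_le_norm y F.2)

noncomputable instance : SeminormedAddCommGroup (CombPre 𝕜 𝓕) :=
  SeminormedAddCommGroup.ofCore (𝕜 := 𝕜) seminormedSpaceCore

noncomputable instance : NormedSpace 𝕜 (CombPre 𝕜 𝓕) where
  norm_smul_le c x := (seminormedSpaceCore.norm_smul c x).le

end CombPre

/-- The combinatorial Banach space `X_𝓕`: the completion of `c₀₀` for the norm given by `𝓕`. -/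
abbrev CombSpace (𝕜 : Type*) [RCLike 𝕜] (𝓕 : Set (Finset ℕ+)) : Type _ :=
  UniformSpace.Completion (CombPre 𝕜 𝓕)

namespace CombSpace

variable {𝕜 : Type*} [RCLike 𝕜] {𝓕 : Set (Finset ℕ+)}

/-- The unit vector `e_i` of `X_𝓕`. -/
noncomputable def basisVec (𝕜 : Type*) [RCLike 𝕜] (𝓕 : Set (Finset ℕ+)) (i : ℕ+) :
    CombSpace 𝕜 𝓕 :=
  ((show CombPre 𝕜 𝓕 from Finsupp.single i (1 : 𝕜) : CombPre 𝕜 𝓕) : CombSpace 𝕜 𝓕)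

/-- The coordinate functional `e_i^*` in the dual of `X_𝓕`, for a family `𝓕` that contains all
singletons: the continuous extension of `x ↦ x(i)` from `c₀₀` to its completion. -/
noncomputable def dualBasisVec (𝕜 : Type*) [RCLike 𝕜] {𝓕 : Set (Finset ℕ+)}
    (h𝓕 : ∀ i : ℕ+, {i} ∈ 𝓕) (i : ℕ+) : StrongDual 𝕜 (CombSpace 𝕜 𝓕) :=
  ContinuousLinearMap.extend
    ((CombPre.coord (𝕜 := 𝕜) (𝓕 := 𝓕) i).mkContinuous 1 fun x => by
      simpa using CombPre.sum_le_norm x (h𝓕 i))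
    (UniformSpace.Completion.toComplL : CombPre 𝕜 𝓕 →L[𝕜] CombSpace 𝕜 𝓕)

theorem dualBasisVec_coe (h𝓕 : ∀ i : ℕ+, {i} ∈ 𝓕) (i : ℕ+) (x : CombPre 𝕜 𝓕) :
    dualBasisVec 𝕜 h𝓕 i (x : CombSpace 𝕜 𝓕) = CombPre.coord i x :=
  ContinuousLinearMap.extend_eq
    ((CombPre.coord (𝕜 := 𝕜) (𝓕 := 𝓕) i).mkContinuous 1 fun x => by
      simpa using CombPre.sum_le_norm x (h𝓕 i))
    (e := (UniformSpace.Completion.toComplL : CombPre 𝕜 𝓕 →L[𝕜] CombSpace 𝕜 𝓕))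
    UniformSpace.Completion.denseRange_coe (UniformSpace.Completion.isUniformInducing_coe _) x

/-- `e_i^*(e_j) = δ_{ij}`. -/
theorem dualBasisVec_basisVec (h𝓕 : ∀ i : ℕ+, {i} ∈ 𝓕) (i j : ℕ+) :
    dualBasisVec 𝕜 h𝓕 i (basisVec 𝕜 𝓕 j) = if j = i then 1 else 0 := by
  classical
  exact (dualBasisVec_coe h𝓕 i _).trans Finsupp.single_apply

end CombSpace

/-!
The Schreier families enter only through five properties (`IsRegularFamily`): heredity together with
spreading, compactness, containment of the first Schreier family, the fact that `{1}` is the only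
member containing `1`, and the possibility to replace the minimum of a member by two larger points
(`push`). They are proved by induction along the definition. For the successor step, a decomposition
`E₁ < … < E_k` is encoded by an increasing colouring (`mem_schreierSucc_iff`).

An isometry of the dual permutes the extreme points of the dual ball. For a maximal member `F` and
unimodular `θ_i` the functional `∑_{i ∈ F} θ_i e_i^*` is extreme (`isExtremeInBall_comb`).
Conversely an extreme functional has coordinates of modulus `0` or `1`, and its support is a member
of the family (`IsExtremeInBall.apply_unit`, `IsExtremeInBall.exists_support`). To see this, split
the norm as the maximum of the contributions of the members avoiding `j` and of those containing
`j`. By Hahn–Banach a functional splits accordingly with additive norms, an extreme one must live on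
one part, and on the second part its `j`-th coordinate may be varied freely in the unit disc.

So for every maximal `F` and all unimodular `θ_i`, the sums `∑_{i ∈ F} θ_i (T e_i^*)(e_j)` have
modulus `0` or `1`. Varying the `θ_i` and `F` shows that each `j` lies in the support of at most one
`T e_i^*`, with a unimodular coordinate (`norm_map_coordL_unit`, `map_coordL_disjoint`). The index
`1`, the only one that lies in no member together with another point, is treated first
(`map_coordL_unit_one`, `map_coordL_one_unit`). The same holds for `T⁻¹`, and therefore
`T e_i^* = θ_i e_{π i}^*` for a permutation `π` of the indices (`exists_map_coordL_eq`) that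
preserves the family. Such a permutation is the identity (`IsRegularFamily.perm_eq_refl`): if
`π i > i`, then sets `{i} ∪ F` that are maximal along a sparse sequence are mapped to sets that are
not maximal.

All of this takes place on `c₀₀`, whose dual is the dual of the completion
(`dualCompletionEquiv`).
-/

/-! ### Regular families -/

/-- The properties of the Schreier families `S_α` on which the argument rests. -/
structure IsRegularFamily (S : Set (Finset ℕ+)) : Prop where
  /-- Heredity and spreading at once: a set that maps into a member `F` by a strictly increasing
  map moving points to the left is itself a member. -/
  spread : ∀ {F G : Finset ℕ+} (ψ : ℕ+ → ℕ+), StrictMonoOn ψ G → (∀ x ∈ G, ψ x ∈ F) →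
    (∀ x ∈ G, ψ x ≤ x) → F ∈ S → G ∈ S
  schreier_subset : schreier ⊆ S
  eq_singleton_one : ∀ {F : Finset ℕ+}, F ∈ S → 1 ∈ F → F = {1}
  /-- Compactness of the family: no infinite set has all its finite subsets in it. -/
  compact : ∀ {A : Set ℕ+}, A.Infinite → ∃ F : Finset ℕ+, ↑F ⊆ A ∧ F ∉ S
  /-- The minimum of a member may be replaced by two larger points below the rest. -/
  push : ∀ {F : Finset ℕ+} {i k y : ℕ+}, (∀ x ∈ F, y < x) → i < k → k < y →
    insert i F ∈ S → insert k (insert y F) ∈ S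

namespace IsRegularFamily

variable {S : Set (Finset ℕ+)}

theorem mono (hS : IsRegularFamily S) {F G : Finset ℕ+} (hF : F ∈ S) (hG : G ⊆ F) : G ∈ S :=
  hS.spread id strictMonoOn_id (fun _ hx => hG hx) (fun _ _ => le_rfl) hF

theorem empty_mem (hS : IsRegularFamily S) : ∅ ∈ S :=
  hS.schreier_subset (by simp [schreier])

theorem pair_mem (hS : IsRegularFamily S) {i j : ℕ+} (hi : i ≠ 1) (hj : j ≠ 1) :
    ({i, j} : Finset ℕ+) ∈ S := by
  have h2 : ∀ k : ℕ+, k ≠ 1 → 2 ≤ (k : ℕ) := fun k hk => by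
    have := one_lt_of_gt (lt_of_le_of_ne one_le hk.symm)
    exact_mod_cast this
  refine hS.schreier_subset fun x hx => Finset.card_le_two.trans ?_
  rcases Finset.mem_insert.mp hx with rfl | hx
  · exact h2 _ hi
  · rw [Finset.mem_singleton.mp hx]; exact h2 _ hj

/-- No strictly increasing sequence of members: its union would contradict compactness. -/
theorem wellFounded (hS : IsRegularFamily S) :
    WellFounded fun F G : S => (G : Finset ℕ+) ⊂ F := by
  refine RelEmbedding.wellFounded_iff_isEmpty.mpr ⟨fun f => ?_⟩
  have hf : StrictMono fun n => ((f n : S) : Finset ℕ+) :=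
    strictMono_nat_of_lt_succ fun n => f.map_rel_iff.mpr (Nat.lt_succ_self n)
  have hinf : (⋃ n, (((f n : S) : Finset ℕ+) : Set ℕ+)).Infinite := by
    intro hfin
    have hsub : ∀ n, ((f n : S) : Finset ℕ+) ⊆ hfin.toFinset := fun n x hx => by
      simpa using ⟨n, hx⟩
    exact (Set.infinite_range_of_injective hf.injective)
      ((Finset.finite_toSet hfin.toFinset.powerset).subset (by
        rintro _ ⟨n, rfl⟩
        simpa using hsub n))
  obtain ⟨F, hFA, hF⟩ := hS.compact hinf
  have hdir : Directed (· ⊆ ·) fun n => (((f n : S) : Finset ℕ+) : Set ℕ+) :=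
    (Monotone.directed_le fun m n hmn => Finset.coe_subset.mpr (hf.monotone hmn))
  obtain ⟨n, hn⟩ := hdir.exists_mem_subset_of_finset_subset_biUnion hFA
  exact hF (hS.mono (f n).2 (by exact_mod_cast hn))

/-- A convenient form of spreading: below the pivot `c ∈ H` the points of `G` are those of `H`,
the points of `G` above `c` are moved to their predecessors in `H`. -/
theorem spread_pred (hS : IsRegularFamily S) {G H : Finset ℕ+} {c : ℕ+} (hH : H ∈ S)
    (hc : c ∈ H) (hcG : c ∉ G) (hlt : ∀ x ∈ G, x < c → x ∈ H)
    (hgt : ∀ x ∈ G, ∀ x' ∈ G, c < x → x < x' → ∃ z ∈ H, x ≤ z ∧ z < x') : G ∈ S := by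
  have hpred : ∀ x, c < x → ((H.filter (· < x)).sup id ∈ H ∧ (H.filter (· < x)).sup id < x) := by
    intro x hx
    have hne : (H.filter (· < x)).Nonempty := ⟨c, Finset.mem_filter.mpr ⟨hc, hx⟩⟩
    obtain ⟨z, hz, hz'⟩ := Finset.exists_mem_eq_sup _ hne id
    rw [hz']
    exact Finset.mem_filter.mp hz
  have hle : ∀ x, ∀ z ∈ H, z < x → z ≤ (H.filter (· < x)).sup id := fun x z hz hzx =>
    Finset.le_sup (f := id) (Finset.mem_filter.mpr ⟨hz, hzx⟩)
  have hcase : ∀ x ∈ G, ¬ x < c → c < x := fun x hx h =>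
    lt_of_le_of_ne (not_lt.mp h) fun h' => hcG (h' ▸ hx)
  refine hS.spread (fun x => if x < c then x else (H.filter (· < x)).sup id) ?_ ?_ ?_ hH
  · intro x hx x' hx' hxx'
    dsimp only
    by_cases h : x < c
    · by_cases h' : x' < c
      · simpa [h, h'] using hxx'
      · simpa [h, h'] using h.trans_le (hle x' c hc (hcase x' hx' h'))
    · have h' : ¬ x' < c := fun h' => h (hxx'.trans h')
      obtain ⟨z, hz, hxz, hzx'⟩ := hgt x hx x' hx' (hcase x hx h) hxx'
      simpa only [h, h', if_false] using
        (hpred x (hcase x hx h)).2.trans_le (hxz.trans (hle x' z hz hzx'))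
  · intro x hx
    by_cases h : x < c
    · simpa [h] using hlt x hx h
    · simpa only [h, if_false] using (hpred x (hcase x hx h)).1
  · intro x hx
    by_cases h : x < c
    · simp [h]
    · simpa only [h, if_false] using (hpred x (hcase x hx h)).2.le

/-- Every member extends to one that is maximal among the members inside `A`. -/
theorem exists_maximal_within (hS : IsRegularFamily S) {G : Finset ℕ+} (hG : G ∈ S) {A : Set ℕ+}
    (hGA : ↑G ⊆ A) :
    ∃ F ∈ S, G ⊆ F ∧ ↑F ⊆ A ∧ ∀ x ∈ A, insert x F ∈ S → x ∈ F := by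
  obtain ⟨F, ⟨hGF, hFA⟩, hmax⟩ := hS.wellFounded.has_min
    {F : S | G ⊆ F ∧ ((F : Finset ℕ+) : Set ℕ+) ⊆ A} ⟨⟨G, hG⟩, Finset.Subset.refl _, hGA⟩
  refine ⟨F, F.2, hGF, hFA, fun x hx hxF => ?_⟩
  by_contra hxn
  refine hmax ⟨insert x F, hxF⟩ ⟨hGF.trans (Finset.subset_insert _ _), ?_⟩
    (Finset.ssubset_insert hxn)
  simpa [Set.insert_subset_iff] using ⟨hx, hFA⟩

/-- Every member `G` extends to a maximal member by points from a given infinite set. By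
spreading, a member that cannot be enlarged far out cannot be enlarged at all. -/
theorem exists_maximal (hS : IsRegularFamily S) {G : Finset ℕ+} (hG : G ∈ S) {N : Set ℕ+}
    (hN : N.Infinite) :
    ∃ F ∈ S, G ⊆ F ∧ ↑F ⊆ ↑G ∪ N ∧ ∀ x, insert x F ∈ S → x ∈ F := by
  obtain ⟨F, hF, hGF, hFA, hmax⟩ := hS.exists_maximal_within hG (A := ↑G ∪ N)
    Set.subset_union_left
  refine ⟨F, hF, hGF, hFA, fun n hn => ?_⟩
  by_contra hnF
  obtain ⟨n', hn'N, hn'⟩ := hN.exists_gt ((insert n F).sup id)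
  have hgt : ∀ x ∈ insert n F, x < n' := fun x hx =>
    (Finset.le_sup (f := id) hx).trans_lt hn'
  have hn'F : n' ∉ F := fun h => lt_irrefl _ (hgt n' (Finset.mem_insert_of_mem h))
  refine hn'F (hmax n' (Or.inr hn'N) ?_)
  refine hS.spread_pred hn (Finset.mem_insert_self _ _) ?_ ?_ ?_
  · intro h
    rcases Finset.mem_insert.mp h with h | h
    · exact (hgt n (Finset.mem_insert_self _ _)).ne h
    · exact hnF h
  · intro x hx hxn
    rcases Finset.mem_insert.mp hx with rfl | h
    · exact absurd (hgt n (Finset.mem_insert_self _ _)) hxn.not_gt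
    · exact Finset.mem_insert_of_mem h
  · intro x hx x' hx' _ hxx'
    rcases Finset.mem_insert.mp hx with rfl | h
    · rcases Finset.mem_insert.mp hx' with rfl | h'
      · exact absurd hxx' (lt_irrefl _)
      · exact absurd (hgt x' (Finset.mem_insert_of_mem h')) hxx'.not_gt
    · exact ⟨x, Finset.mem_insert_of_mem h, le_rfl, hxx'⟩

end IsRegularFamily

/-! ### The Schreier families are regular -/

theorem isRegularFamily_schreier : IsRegularFamily schreier where
  spread {F G} ψ hψ hm hle hF := by
    intro x hx
    have h1 : G.card ≤ F.card := Finset.card_le_card_of_injOn ψ hm hψ.injOn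
    exact h1.trans ((hF _ (hm x hx)).trans (PNat.coe_le_coe _ _ |>.mpr (hle x hx)))
  schreier_subset := subset_rfl
  eq_singleton_one {F} hF h1 :=
    (Finset.eq_of_subset_of_card_le (Finset.singleton_subset_iff.mpr h1)
      (by simpa using hF 1 h1)).symm
  compact {A} hA := by
    obtain ⟨a, ha⟩ := hA.nonempty
    obtain ⟨F, hFA, hF⟩ := hA.exists_subset_card_eq ((a : ℕ) + 1)
    refine ⟨insert a F, by simpa [Set.insert_subset_iff] using ⟨ha, hFA⟩, fun h => ?_⟩
    have h1 := h a (Finset.mem_insert_self _ _)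
    have h2 := Finset.card_le_card (Finset.subset_insert a F)
    omega
  push {F i k y} hy hik hky hF := by
    have hiF : i ∉ F := fun h => lt_irrefl _ ((hy i h).trans (hik.trans hky))
    have h1 := hF i (Finset.mem_insert_self _ _)
    rw [Finset.card_insert_of_notMem hiF] at h1
    have h2 : (insert k (insert y F)).card ≤ F.card + 2 :=
      (Finset.card_insert_le _ _).trans (by linarith [Finset.card_insert_le y F])
    intro x hx
    have hkx : k ≤ x := by
      rcases Finset.mem_insert.mp hx with rfl | hx
      · exact le_rfl
      · rcases Finset.mem_insert.mp hx with rfl | hx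
        · exact hky.le
        · exact (hky.trans (hy x hx)).le
    have h3 : (i : ℕ) < k := hik
    have h4 : (k : ℕ) ≤ x := hkx
    omega

/-- The decomposition `E₁ < … < E_k` in the successor step, encoded by an increasing colouring
with at most `min F` colours whose colour classes are in `S`. -/
theorem mem_schreierSucc_iff {S : Set (Finset ℕ+)} {F : Finset ℕ+} :
    F ∈ schreierSucc S ↔ ∃ (g : ℕ+ → ℕ) (k : ℕ), MonotoneOn g F ∧
      (∀ x ∈ F, g x < k ∧ k ≤ x) ∧ ∀ x ∈ F, F.filter (fun z => g z = g x) ∈ S := by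
  classical
  constructor
  · rintro ⟨k, E, hne, hES, hlt, hmin, rfl⟩
    have huniq : ∀ {x i j}, x ∈ E i → x ∈ E j → i = j := by
      intro x i j hi hj
      by_contra hij
      rcases lt_or_gt_of_ne hij with h | h
      · exact lt_irrefl _ (hlt _ _ h x hi x hj)
      · exact lt_irrefl _ (hlt _ _ h x hj x hi)
    set g : ℕ+ → ℕ := fun x => if h : ∃ j, x ∈ E j then (h.choose : ℕ) else 0 with hg
    have hgE : ∀ {x j}, x ∈ E j → g x = j := by
      intro x j hx
      have h : ∃ j, x ∈ E j := ⟨j, hx⟩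
      simp only [hg, dif_pos h]
      rw [huniq h.choose_spec hx]
    have hcard : (Finset.univ.image fun j => (E j).min' (hne j)).card = k := by
      rw [Finset.card_image_of_injective, Finset.card_univ, Fintype.card_fin]
      intro i j hij
      exact huniq ((E i).min'_mem (hne i)) (by
        have := (E j).min'_mem (hne j)
        rwa [← show (E i).min' (hne i) = (E j).min' (hne j) from hij] at this)
    refine ⟨g, k, ?_, ?_, ?_⟩
    · intro x hx y hy hxy
      simp only [Finset.coe_biUnion, Finset.coe_univ, Set.mem_univ, Set.iUnion_true,
        Set.mem_iUnion, Finset.mem_coe] at hx hy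
      obtain ⟨i, hi⟩ := hx
      obtain ⟨j, hj⟩ := hy
      rw [hgE hi, hgE hj]
      by_contra hlt'
      exact absurd (hlt j i (by simpa using hlt') y hj x hi) hxy.not_gt
    · intro x hx
      obtain ⟨j, -, hj⟩ := Finset.mem_biUnion.mp hx
      refine ⟨(hgE hj).trans_lt j.2, ?_⟩
      have := hmin _ (Finset.mem_image_of_mem _ (Finset.mem_univ j))
      rw [hcard] at this
      exact this.trans (PNat.coe_le_coe _ _ |>.mpr ((E j).min'_le x hj))
    · intro x hx
      obtain ⟨j, -, hj⟩ := Finset.mem_biUnion.mp hx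
      convert hES j using 1
      ext z
      simp only [Finset.mem_filter, Finset.mem_biUnion, Finset.mem_univ, true_and]
      constructor
      · rintro ⟨⟨i, hi⟩, h⟩
        rw [hgE hi, hgE hj] at h
        rwa [← Fin.ext h]
      · intro hz
        exact ⟨⟨j, hz⟩, by rw [hgE hz, hgE hj]⟩
  · rintro ⟨g, k, hg, hk, hS⟩
    set I := F.image g with hI
    set o := I.orderEmbOfFin rfl with ho
    have hoI : ∀ j, ∃ x ∈ F, g x = o j := fun j =>
      Finset.mem_image.mp (I.orderEmbOfFin_mem rfl j)
    have hne : ∀ j, (F.filter fun z => g z = o j).Nonempty := fun j => by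
      obtain ⟨x, hx, hxj⟩ := hoI j
      exact ⟨x, Finset.mem_filter.mpr ⟨hx, hxj⟩⟩
    refine ⟨I.card, fun j => F.filter fun z => g z = o j, hne, ?_, ?_, ?_, ?_⟩
    · intro j
      obtain ⟨x, hx, hxj⟩ := hoI j
      have := hS x hx
      rwa [hxj] at this
    · intro i j hij x hx y hy
      rw [Finset.mem_filter] at hx hy
      by_contra hyx
      have := hg hy.1 hx.1 (not_lt.mp hyx)
      rw [hx.2, hy.2] at this
      exact absurd (o.lt_iff_lt.mpr hij) this.not_gt
    · intro m hm
      obtain ⟨j, -, rfl⟩ := Finset.mem_image.mp hm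
      have hmF := (Finset.mem_filter.mp ((F.filter fun z => g z = o j).min'_mem (hne j))).1
      have h1 : I.card ≤ k := by
        have : I ⊆ Finset.range k := fun c hc => by
          obtain ⟨x, hx, rfl⟩ := Finset.mem_image.mp hc
          exact Finset.mem_range.mpr (hk x hx).1
        simpa using Finset.card_le_card this
      have h2 := Finset.card_image_le (s := Finset.univ)
        (f := fun j => (F.filter fun z => g z = o j).min' (hne j))
      rw [Finset.card_univ, Fintype.card_fin] at h2
      exact h2.trans (h1.trans (hk _ hmF).2)
    · ext x
      simp only [Finset.mem_biUnion, Finset.mem_univ, true_and, Finset.mem_filter]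
      constructor
      · intro hx
        have : g x ∈ Set.range o := by
          rw [ho, Finset.range_orderEmbOfFin]
          exact Finset.mem_coe.mpr (Finset.mem_image_of_mem g hx)
        obtain ⟨j, hj⟩ := this
        exact ⟨j, hx, hj.symm⟩
      · rintro ⟨-, hx, -⟩
        exact hx

/-- An infinite set contains a finite set that is not a union of `k` successive members. -/
theorem IsRegularFamily.exists_not_coverable {S : Set (Finset ℕ+)} (hS : IsRegularFamily S)
    (k : ℕ) {A : Set ℕ+} (hA : A.Infinite) :
    ∃ F : Finset ℕ+, ↑F ⊆ A ∧ ∀ g : ℕ+ → ℕ, MonotoneOn g F → (∀ x ∈ F, g x < k) →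
      ∃ x ∈ F, F.filter (fun z => g z = g x) ∉ S := by
  induction k with
  | zero =>
    obtain ⟨a, ha⟩ := hA.nonempty
    exact ⟨{a}, by simpa using ha, fun g _ h => absurd (h a (by simp)) (by simp)⟩
  | succ k ih =>
    obtain ⟨F₁, h₁A, h₁⟩ := ih
    have hA' : (A ∩ Set.Ioi (F₁.sup id)).Infinite := by
      intro hfin
      refine hA ((hfin.union (Set.finite_Iic (F₁.sup id))).subset fun x hx => ?_)
      rcases le_or_gt x (F₁.sup id) with h | h
      · exact Or.inr h
      · exact Or.inl ⟨hx, h⟩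
    obtain ⟨F₂, h₂A, h₂⟩ := hS.compact hA'
    refine ⟨F₁ ∪ F₂, ?_, fun g hg hgk => ?_⟩
    · rw [Finset.coe_union]
      exact Set.union_subset h₁A fun x hx => (h₂A hx).1
    by_cases hall : ∀ x ∈ F₁, g x < k
    · obtain ⟨x, hx, hxS⟩ := h₁ g (hg.mono (by simp)) hall
      exact ⟨x, Finset.mem_union_left _ hx, fun h => hxS (hS.mono h
        (Finset.filter_subset_filter _ Finset.subset_union_left))⟩
    · -- the last colour is used in `F₁`, so `F₂` lies in one colour class
      push Not at hall
      obtain ⟨x, hx, hxk⟩ := hall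
      have hx' := Finset.mem_union_left F₂ hx
      refine ⟨x, hx', fun h => h₂ (hS.mono h fun z hz => ?_)⟩
      have hz' := Finset.mem_union_right F₁ hz
      have hxz : x ≤ z := (Finset.le_sup (f := id) hx).trans (h₂A hz).2.le
      refine Finset.mem_filter.mpr ⟨hz', ?_⟩
      have h1 := hg (Finset.mem_coe.mpr hx') (Finset.mem_coe.mpr hz') hxz
      have h2 := hgk z hz'
      have h3 := hgk x hx'
      omega

theorem IsRegularFamily.schreierSucc {S : Set (Finset ℕ+)} (hS : IsRegularFamily S) :
    IsRegularFamily (schreierSucc S) where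
  spread {F G} ψ hψ hm hle hF := by
    obtain ⟨g, k, hg, hk, hgS⟩ := mem_schreierSucc_iff.mp hF
    refine mem_schreierSucc_iff.mpr ⟨g ∘ ψ, k, hg.comp hψ.monotoneOn hm, fun x hx =>
      ⟨(hk _ (hm x hx)).1, (hk _ (hm x hx)).2.trans (PNat.coe_le_coe _ _ |>.mpr (hle x hx))⟩,
      fun x hx => hS.spread ψ (hψ.mono fun z hz => (Finset.mem_filter.mp hz).1) ?_ ?_
        (hgS _ (hm x hx))⟩
    · intro z hz
      rw [Finset.mem_filter] at hz
      exact Finset.mem_filter.mpr ⟨hm z hz.1, hz.2⟩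
    · intro z hz
      exact hle z (Finset.mem_filter.mp hz).1
  schreier_subset F hF := by
    refine mem_schreierSucc_iff.mpr ⟨fun _ => 0, 1, fun _ _ _ _ _ => le_rfl, fun x _ =>
      ⟨one_pos, x.pos⟩, fun x _ => ?_⟩
    simpa using hS.schreier_subset hF
  eq_singleton_one {F} hF h1 := by
    obtain ⟨g, k, hg, hk, hgS⟩ := mem_schreierSucc_iff.mp hF
    have hk1 := (hk 1 h1).2
    have h0 : ∀ x ∈ F, g x = 0 := fun x hx => by
      have := (hk x hx).1
      simp only [PNat.one_coe] at hk1
      omega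
    have := hgS 1 h1
    rw [Finset.filter_true_of_mem fun x hx => by rw [h0 x hx, h0 1 h1]] at this
    exact hS.eq_singleton_one this h1
  compact {A} hA := by
    obtain ⟨a, ha⟩ := hA.nonempty
    obtain ⟨F, hFA, hF⟩ := hS.exists_not_coverable a hA
    refine ⟨insert a F, by simpa [Set.insert_subset_iff] using ⟨ha, hFA⟩, fun h => ?_⟩
    obtain ⟨g, k, hg, hk, hgS⟩ := mem_schreierSucc_iff.mp h
    obtain ⟨x, hx, hxS⟩ := hF g (hg.mono (by simp)) fun x hx =>
      ((hk x (Finset.mem_insert_of_mem hx)).1).trans_le (hk a (Finset.mem_insert_self _ _)).2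
    exact hxS (hS.mono (hgS x (Finset.mem_insert_of_mem hx))
      (Finset.filter_subset_filter _ (Finset.subset_insert _ _)))
  push {F i k y} hy hik hky hF := by
    obtain ⟨g, m, hg, hm, hgS⟩ := mem_schreierSucc_iff.mp hF
    have hi := Finset.mem_insert_self i F
    have hFi : ∀ {x}, x ∈ F → x ∈ insert i F := fun hx => Finset.mem_insert_of_mem hx
    have hiy : i < y := hik.trans hky
    -- `k` and `y` receive the colour of `i`
    set g' : ℕ+ → ℕ := fun x => if x ≤ y then g i else g x with hg'
    have hk' : g' k = g i := if_pos hky.le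
    have hy' : g' y = g i := if_pos le_rfl
    have hF' : ∀ x ∈ F, g' x = g x := fun x hx => if_neg (hy x hx).not_ge
    have hmem : ∀ x ∈ insert k (insert y F), x ≤ y ∧ k ≤ x ∨ x ∈ F := by
      intro x hx
      rcases Finset.mem_insert.mp hx with rfl | hx
      · exact Or.inl ⟨hky.le, le_rfl⟩
      · rcases Finset.mem_insert.mp hx with rfl | hx
        · exact Or.inl ⟨le_rfl, hky.le⟩
        · exact Or.inr hx
    refine mem_schreierSucc_iff.mpr ⟨g', m, ?_, ?_, ?_⟩
    · intro x hx z hz hxz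
      rcases hmem x hx with ⟨h, -⟩ | h <;> rcases hmem z hz with ⟨h', -⟩ | h'
      · simp [hg', h, h']
      · rw [hF' z h', show g' x = g i from if_pos h]
        exact hg hi (hFi h') (hiy.trans (hy z h')).le
      · exact absurd (hxz.trans h') (hy x h).not_ge
      · rw [hF' z h', hF' x h]
        exact hg (hFi h) (hFi h') hxz
    · intro x hx
      rcases hmem x hx with ⟨h, h'⟩ | h
      · rw [show g' x = g i from if_pos h]
        exact ⟨(hm i hi).1, (hm i hi).2.trans (PNat.coe_le_coe _ _ |>.mpr (hik.le.trans h'))⟩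
      · rw [hF' x h]
        exact hm x (hFi h)
    · intro x hx
      have hfF : ∀ c, F.filter (fun z => g' z = c) = F.filter (fun z => g z = c) := fun c =>
        Finset.filter_congr fun z hz => by rw [hF' z hz]
      by_cases hc : g' x = g i
      · rw [hc, Finset.filter_insert, if_pos hk', Finset.filter_insert, if_pos hy', hfF]
        refine hS.push (fun z hz => hy z (Finset.mem_filter.mp hz).1) hik hky ?_
        have := hgS i hi
        rwa [Finset.filter_insert, if_pos rfl] at this
      · rw [Finset.filter_insert, if_neg (by rw [hk']; exact fun h => hc h.symm),
          Finset.filter_insert, if_neg (by rw [hy']; exact fun h => hc h.symm), hfF]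
        rcases hmem x hx with ⟨h, -⟩ | h
        · exact absurd (if_pos h) hc
        · rw [hF' x h]
          exact hS.mono (hgS x (hFi h))
            (Finset.filter_subset_filter _ (Finset.subset_insert _ _))

/-- The diagonal construction of the limit step preserves regularity. -/
theorem isRegularFamily_diagonal {S : ℕ+ → Set (Finset ℕ+)} (hS : ∀ n, IsRegularFamily (S n)) :
    IsRegularFamily {F | ∃ n : ℕ+, F ∈ S n ∧ ∀ i ∈ F, n ≤ i} where
  spread ψ hψ hm hle := by
    rintro ⟨n, hF, hn⟩
    exact ⟨n, (hS n).spread ψ hψ hm hle hF, fun i hi => (hn _ (hm i hi)).trans (hle i hi)⟩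
  schreier_subset F hF := ⟨1, (hS 1).schreier_subset hF, fun _ _ => one_le⟩
  eq_singleton_one := by
    rintro F ⟨n, hF, -⟩ h1
    exact (hS n).eq_singleton_one hF h1
  compact {A} hA := by
    obtain ⟨a, ha⟩ := hA.nonempty
    choose F hFA hF using fun n => (hS n).compact hA
    refine ⟨insert a ((Finset.Iic a).biUnion F), ?_, ?_⟩
    · simpa [Set.insert_subset_iff] using ⟨ha, fun n _ => hFA n⟩
    · rintro ⟨n, hn, hle⟩
      refine hF n ((hS n).mono hn ?_)
      exact (Finset.subset_biUnion_of_mem F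
        (Finset.mem_Iic.mpr (hle a (Finset.mem_insert_self _ _)))).trans
        (Finset.subset_insert _ _)
  push {F i k y} hy hik hky := by
    rintro ⟨n, hF, hn⟩
    have hni := hn i (Finset.mem_insert_self _ _)
    refine ⟨n, (hS n).push hy hik hky hF, fun x hx => ?_⟩
    rcases Finset.mem_insert.mp hx with rfl | hx
    · exact hni.trans hik.le
    · rcases Finset.mem_insert.mp hx with rfl | hx
      · exact hni.trans (hik.trans hky).le
      · exact hn x (Finset.mem_insert_of_mem hx)

theorem isRegularFamily_schreierFamily {a : Ordinal.{0} → ℕ+ → Ordinal.{0}}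
    (ha : IsLimitSystem a) {α : Ordinal.{0}} (h1 : 1 ≤ α) (hα : α < ω₁) :
    IsRegularFamily (schreierFamily a α) := by
  induction α using Ordinal.limitRecOn with
  | zero => simp at h1
  | add_one β ih =>
    rcases eq_or_ne β 0 with rfl | hβ
    · rw [zero_add, schreierFamily_one]
      exact isRegularFamily_schreier
    · have hβ1 : 1 ≤ β := Order.one_le_iff_ne_zero.mpr hβ
      rw [schreierFamily_add_one a hβ1]
      exact (ih hβ1 (lt_of_le_of_lt (Order.lt_add_one_iff.mpr le_rfl).le hα)).schreierSucc
  | limit l hl ih =>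
    rw [schreierFamily_limit ha hl hα]
    exact isRegularFamily_diagonal fun n =>
      ih _ ((ha l hl hα).2.1 n).2 ((ha l hl hα).2.1 n).1 (((ha l hl hα).2.1 n).2.trans hα)

/-! ### Permutations that preserve a regular family -/

/-- A permutation of `ℕ+` moves some point beyond any given one weakly to the left. -/
theorem exists_gt_perm_le (π : Equiv.Perm ℕ+) (M : ℕ+) : ∃ n, M < n ∧ π n ≤ n := by
  by_contra! h
  -- otherwise `π⁻¹` would map `[1, M + 1]` into `[1, M]`
  have hsub : (Finset.Iic (M + 1)).map π.symm.toEmbedding ⊆ Finset.Iic M := by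
    intro n hn
    obtain ⟨m, hm, rfl⟩ := Finset.mem_map.mp hn
    rw [Finset.mem_Iic] at hm ⊢
    by_contra hlt
    have h1 := h _ (not_le.mp hlt)
    simp only [Equiv.coe_toEmbedding, Equiv.apply_symm_apply] at h1 hlt
    exact hlt (PNat.lt_add_one_iff.mp (h1.trans_le hm))
  have h1 := Finset.card_le_card hsub
  rw [Finset.card_map] at h1
  have h2 : Finset.Iic M ⊂ Finset.Iic (M + 1) :=
    Finset.Iic_ssubset_Iic.mpr (PNat.lt_add_right M 1)
  exact absurd (Finset.card_lt_card h2) h1.not_gt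

/-- Moreover the image of that point may be required to lie beyond the given one as well. -/
theorem exists_gt_perm_gt_le (π : Equiv.Perm ℕ+) (M : ℕ+) : ∃ n, M < n ∧ M < π n ∧ π n ≤ n := by
  obtain ⟨n, hn, hπ⟩ := exists_gt_perm_le π (M + (Finset.Iic M).sup π.symm)
  have hM : M < n := (PNat.lt_add_right M _).trans hn
  refine ⟨n, hM, ?_, hπ⟩
  by_contra hle
  have h1 := Finset.le_sup (f := π.symm) (Finset.mem_Iic.mpr (not_lt.mp hle))
  rw [Equiv.symm_apply_apply] at h1
  exact absurd ((h1.trans (PNat.lt_add_left _ M).le).trans_lt hn) (lt_irrefl _)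

namespace IsRegularFamily

variable {S : Set (Finset ℕ+)}

/-- A permutation `π` with `π F ∈ S ↔ F ∈ S` moves no point to the right. If `i < π i = k`, take
a sequence `k + 1 < π n₁ ≤ n₁ < π n₂ ≤ n₂ < …` and a maximal set `F` of its terms with
`{i} ∪ F ∈ S`. Then `{k, k + 1} ∪ F ∈ S`, and this spreads to `{k} ∪ π (F ∪ {m})` for a further
term `m`, so `F` was not maximal. -/
theorem perm_le (hS : IsRegularFamily S) (π : Equiv.Perm ℕ+)
    (hπ : ∀ F : Finset ℕ+, F.map π.toEmbedding ∈ S ↔ F ∈ S) (i : ℕ+) : π i ≤ i := by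
  classical
  by_contra! hik
  set k := π i with hk
  choose s hs1 hs2 hs3 using exists_gt_perm_gt_le π
  -- `n 0 = k + 1` is an auxiliary start, the terms are `n 1, n 2, …`
  let n : ℕ → ℕ+ := fun t => Nat.rec (k + 1) (fun _ m => s m) t
  have hn : ∀ t, n (t + 1) = s (n t) := fun _ => rfl
  have hmono : StrictMono n := strictMono_nat_of_lt_succ fun t => by rw [hn]; exact hs1 _
  have hk1 : ∀ t, k + 1 < n (t + 1) := fun t => hmono (Nat.succ_pos t)
  have hgap : ∀ {t u}, t < u → n t < π (n u) := by
    intro t u htu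
    obtain ⟨u, rfl⟩ := Nat.exists_eq_succ_of_ne_zero (Nat.ne_zero_of_lt htu)
    exact (hmono.monotone (Nat.lt_succ_iff.mp htu)).trans_lt (hs2 (n u))
  have hle : ∀ t, π (n (t + 1)) ≤ n (t + 1) := fun t => hs3 _
  set N : Set ℕ+ := Set.range fun t => n (t + 1) with hN
  have hNinf : N.Infinite := Set.infinite_range_of_injective fun t u h =>
    Nat.succ_injective (hmono.injective h)
  have hkk : k < k + 1 := PNat.lt_add_right k 1
  have hi : ({i} : Finset ℕ+) ∈ S := hS.schreier_subset fun x _ => by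
    rw [Finset.card_singleton]; exact x.pos
  obtain ⟨G, hG, hiG, hGN, hmax⟩ := hS.exists_maximal_within hi (A := insert i N) (by simp)
  set F := G.erase i with hF
  have hGF : insert i F = G := Finset.insert_erase (hiG (Finset.mem_singleton_self i))
  have hFN : ∀ x ∈ F, ∃ t, n (t + 1) = x := fun x hx =>
    (hGN (Finset.mem_of_mem_erase hx)).resolve_left (Finset.ne_of_mem_erase hx)
  have hFk : ∀ x ∈ F, k + 1 < x := fun x hx => by
    obtain ⟨t, rfl⟩ := hFN x hx
    exact hk1 t
  have hH : insert k (insert (k + 1) F) ∈ S := hS.push hFk hik hkk (by rwa [hGF])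
  -- a further term `m`
  obtain ⟨_, ⟨u, rfl⟩, hu⟩ := hNinf.exists_gt (G.sup id)
  set m := n (u + 1) with hm
  have hGm : ∀ x ∈ G, x < m := fun x hx => (Finset.le_sup (f := id) hx).trans_lt hu
  have hmG : m ∉ G := fun h => lt_irrefl _ (hGm m h)
  refine hmG (hmax m (Or.inr ⟨u, rfl⟩) ((hπ _).mp ?_))
  have hterm : ∀ x ∈ (insert m G).map π.toEmbedding, x = k ∨ ∃ t, x = π (n (t + 1)) ∧
      (n (t + 1) = m ∨ n (t + 1) ∈ F) := by
    intro x hx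
    obtain ⟨z, hz, rfl⟩ := Finset.mem_map.mp hx
    rcases Finset.mem_insert.mp hz with rfl | hz
    · exact Or.inr ⟨u, rfl, Or.inl rfl⟩
    · rw [← hGF] at hz
      rcases Finset.mem_insert.mp hz with rfl | hz
      · exact Or.inl rfl
      · obtain ⟨t, rfl⟩ := hFN z hz
        exact Or.inr ⟨t, rfl, Or.inr hz⟩
  have hk1π : ∀ t, k + 1 < π (n (t + 1)) := fun t => hgap (t := 0) (Nat.succ_pos t)
  refine hS.spread_pred (c := k + 1) hH (by simp) ?_ ?_ ?_
  · intro h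
    rcases hterm _ h with h | ⟨t, h, -⟩
    · exact hkk.ne' h
    · exact (hk1π t).ne h
  · intro x hx hxk
    rcases hterm _ hx with rfl | ⟨t, rfl, -⟩
    · simp
    · exact absurd (hk1π t) hxk.not_gt
  · intro x hx x' hx' hcx hxx'
    rcases hterm _ hx with rfl | ⟨t, rfl, ht⟩
    · exact absurd hkk hcx.not_gt
    rcases hterm _ hx' with rfl | ⟨t', rfl, ht'⟩
    · exact absurd (hkk.trans hcx) hxx'.not_gt
    have htt : t < t' := by
      by_contra hge
      rcases (not_lt.mp hge).eq_or_lt with rfl | hlt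
      · exact lt_irrefl _ hxx'
      · exact absurd (hxx'.trans_le ((hle t').trans (hgap (Nat.succ_lt_succ hlt)).le))
          (lt_irrefl _)
    have hlt : n (t + 1) < n (t' + 1) := hmono (Nat.succ_lt_succ htt)
    refine ⟨n (t + 1), ?_, hle t, hgap (Nat.succ_lt_succ htt)⟩
    rcases ht with ht | ht
    · rcases ht' with ht' | ht'
      · exact absurd (ht.trans ht'.symm) hlt.ne
      · exact absurd (ht ▸ hlt) (hGm _ (Finset.mem_of_mem_erase ht')).not_gt
    · simp [ht]

/-- A permutation that preserves a regular family is the identity. -/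
theorem perm_eq_refl (hS : IsRegularFamily S) (π : Equiv.Perm ℕ+)
    (hπ : ∀ F : Finset ℕ+, F.map π.toEmbedding ∈ S ↔ F ∈ S) (i : ℕ+) : π i = i := by
  refine le_antisymm (hS.perm_le π hπ i) ?_
  have := hS.perm_le π.symm (fun F => by
    rw [← hπ, Finset.map_map]
    convert Iff.rfl using 2
    ext x
    simp) (π i)
  rwa [Equiv.symm_apply_apply] at this

end IsRegularFamily

/-! ### Extreme points of a unit ball -/

/-- `f` is an extreme point of the closed unit ball: `f` is not the midpoint of two other points
`f + g` and `f - g` of the ball. -/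
def IsExtremeInBall {E : Type*} [SeminormedAddCommGroup E] (f : E) : Prop :=
  ‖f‖ ≤ 1 ∧ ∀ g, ‖f + g‖ ≤ 1 → ‖f - g‖ ≤ 1 → g = 0

theorem IsExtremeInBall.map {𝕜 E E' : Type*} [RCLike 𝕜] [SeminormedAddCommGroup E]
    [SeminormedAddCommGroup E'] [NormedSpace 𝕜 E] [NormedSpace 𝕜 E'] {f : E}
    (hf : IsExtremeInBall f) (T : E ≃ₗᵢ[𝕜] E') : IsExtremeInBall (T f) := by
  refine ⟨(T.norm_map f).trans_le hf.1, fun g h1 h2 => ?_⟩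
  have h : T.symm g = 0 := by
    refine hf.2 _ ?_ ?_
    · rwa [← T.norm_map, map_add, T.apply_symm_apply]
    · rwa [← T.norm_map, map_sub, T.apply_symm_apply]
  rw [← T.apply_symm_apply g, h, map_zero]

/-- A functional on a sup-normed product has at least the sum of the norms of its parts. -/
theorem norm_add_norm_le_of_prod {𝕜 E₁ E₂ : Type*} [RCLike 𝕜] [SeminormedAddCommGroup E₁]
    [SeminormedAddCommGroup E₂] [NormedSpace 𝕜 E₁] [NormedSpace 𝕜 E₂]
    {Φ : StrongDual 𝕜 (E₁ × E₂)} {f : StrongDual 𝕜 E₁} {g : StrongDual 𝕜 E₂}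
    (h : ∀ x y, Φ (x, y) = f x + g y) : ‖f‖ + ‖g‖ ≤ ‖Φ‖ := by
  have key : ∀ x y, ‖x‖ = 1 → ‖y‖ = 1 → ‖f x‖ + ‖g y‖ ≤ ‖Φ‖ := by
    intro x y hx hy
    obtain ⟨c, hc, hcx⟩ := RCLike.exists_norm_eq_mul_self (f x)
    obtain ⟨d, hd, hdy⟩ := RCLike.exists_norm_eq_mul_self (g y)
    have h1 : Φ (c • x, d • y) = ((‖f x‖ + ‖g y‖ : ℝ) : 𝕜) := by
      rw [h, map_smul, map_smul, smul_eq_mul, smul_eq_mul, RCLike.ofReal_add, hcx, hdy]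
    have h2 : ‖((c • x, d • y) : E₁ × E₂)‖ ≤ 1 := by
      rw [Prod.norm_mk, norm_smul, norm_smul, hc, hd, one_mul, one_mul]
      exact max_le hx.le hy.le
    have h3 := Φ.le_of_opNorm_le_of_le le_rfl h2
    rwa [h1, RCLike.norm_of_nonneg (add_nonneg (norm_nonneg _) (norm_nonneg _)), mul_one] at h3
  have hf : ‖f‖ ≤ ‖Φ‖ := f.opNorm_le_bound (norm_nonneg _) fun x => by
    have := Φ.le_opNorm (x, 0)
    rwa [h, map_zero, add_zero, Prod.norm_mk, norm_zero, max_eq_left (norm_nonneg _)] at this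
  have hg : ‖g‖ ≤ ‖Φ‖ := g.opNorm_le_bound (norm_nonneg _) fun y => by
    have := Φ.le_opNorm (0, y)
    rwa [h, map_zero, zero_add, Prod.norm_mk, norm_zero, max_eq_right (norm_nonneg _)] at this
  rw [← le_sub_iff_add_le]
  refine ContinuousLinearMap.opNorm_le_of_unit_norm (𝕜 := 𝕜) (sub_nonneg.mpr hg) fun x hx => ?_
  rw [le_sub_comm]
  refine ContinuousLinearMap.opNorm_le_of_unit_norm (𝕜 := 𝕜) ?_ fun y hy => ?_
  · have := f.le_opNorm x
    rw [hx, mul_one] at this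
    linarith
  · linarith [key x y hx hy]

/-! ### The dual of a combinatorial space -/

namespace CombPre

variable {𝕜 : Type*} [RCLike 𝕜] {𝓕 𝓖 : Set (Finset ℕ+)}

/-- The unit vector `e_i` of `c₀₀`. -/
noncomputable def unit (𝕜 : Type*) [RCLike 𝕜] (𝓕 : Set (Finset ℕ+)) (i : ℕ+) : CombPre 𝕜 𝓕 :=
  Finsupp.single (M := 𝕜) i 1

theorem coord_unit (i j : ℕ+) : coord j (unit 𝕜 𝓕 i) = if i = j then 1 else 0 := by
  classical
  exact Finsupp.single_apply

theorem norm_le {x : CombPre 𝕜 𝓕} {C : ℝ} (hC : 0 ≤ C)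
    (h : ∀ F ∈ 𝓕, ∑ i ∈ F, ‖coord i x‖ ≤ C) : ‖x‖ ≤ C :=
  Real.iSup_le (fun F => h F.1 F.2) hC

theorem norm_unit_le (i : ℕ+) : ‖unit 𝕜 𝓕 i‖ ≤ 1 := by
  refine norm_le zero_le_one fun F _ => ?_
  simp only [coord_unit]
  rw [Finset.sum_congr rfl fun j _ => apply_ite norm (i = j) (1 : 𝕜) 0]
  simp only [norm_one, norm_zero, Finset.sum_ite_eq]
  split_ifs <;> norm_num

theorem dual_ext {f g : StrongDual 𝕜 (CombPre 𝕜 𝓕)}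
    (h : ∀ i, f (unit 𝕜 𝓕 i) = g (unit 𝕜 𝓕 i)) : f = g := by
  refine ContinuousLinearMap.coe_injective ?_
  exact Finsupp.lhom_ext' (M := 𝕜) fun i => LinearMap.ext_ring (h i)

/-- The vector `∑_{i ∈ B} c_i e_i`. -/
noncomputable def vec (𝓕 : Set (Finset ℕ+)) (B : Finset ℕ+) (c : ℕ+ → 𝕜) : CombPre 𝕜 𝓕 :=
  ∑ i ∈ B, c i • unit 𝕜 𝓕 i

theorem coord_vec (B : Finset ℕ+) (c : ℕ+ → 𝕜) (j : ℕ+) :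
    coord j (vec 𝓕 B c) = if j ∈ B then c j else 0 := by
  simp [vec, map_sum, coord_unit]

/-- If `B ∉ 𝓕`, then a member of `𝓕` misses a point of `B`, so a vector supported on `B` with
coordinates in the unit disc has norm at most `|B| - 1`. -/
theorem norm_vec_le (h𝓕 : ∀ F ∈ 𝓕, ∀ G ⊆ F, G ∈ 𝓕) (h0 : ∅ ∈ 𝓕) {B : Finset ℕ+} (hB : B ∉ 𝓕)
    {c : ℕ+ → 𝕜} (hc : ∀ i ∈ B, ‖c i‖ ≤ 1) : ‖vec 𝓕 B c‖ ≤ B.card - 1 := by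
  have hne : 1 ≤ B.card := by
    rw [Finset.one_le_card]
    exact Finset.nonempty_iff_ne_empty.mpr fun h => hB (h ▸ h0)
  refine norm_le (by simpa using hne) fun G hG => ?_
  have hss : G ∩ B ⊂ B := by
    refine Finset.ssubset_iff_subset_ne.mpr ⟨Finset.inter_subset_right, fun h => hB ?_⟩
    exact h𝓕 G hG B (Finset.inter_eq_right.mp h)
  calc ∑ i ∈ G, ‖coord i (vec 𝓕 B c)‖
      = ∑ i ∈ G ∩ B, ‖c i‖ := by
        rw [← Finset.filter_mem_eq_inter, Finset.sum_filter]
        refine Finset.sum_congr rfl fun i _ => ?_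
        rw [coord_vec, apply_ite norm, norm_zero]
    _ ≤ ∑ i ∈ G ∩ B, 1 := Finset.sum_le_sum fun i hi => hc i (Finset.mem_inter.mp hi).2
    _ = ((G ∩ B).card : ℝ) := by simp
    _ ≤ B.card - 1 := by
        have : (((G ∩ B).card + 1 : ℕ) : ℝ) ≤ B.card :=
          Nat.cast_le.mpr (Nat.succ_le_of_lt (Finset.card_lt_card hss))
        push_cast at this
        linarith

/-- The coordinate functional `e_i^*` on `c₀₀`. -/
noncomputable def coordL (h𝓕 : ∀ i : ℕ+, {i} ∈ 𝓕) (i : ℕ+) : StrongDual 𝕜 (CombPre 𝕜 𝓕) :=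
  (coord i).mkContinuous 1 fun x => by simpa using sum_le_norm x (h𝓕 i)

theorem coordL_apply (h𝓕 : ∀ i : ℕ+, {i} ∈ 𝓕) (i : ℕ+) (x : CombPre 𝕜 𝓕) :
    coordL h𝓕 i x = coord i x := rfl

/-- The functional `∑_{i ∈ F} θ_i e_i^*`. -/
noncomputable def comb (h𝓕 : ∀ i : ℕ+, {i} ∈ 𝓕) (F : Finset ℕ+) (θ : ℕ+ → 𝕜) :
    StrongDual 𝕜 (CombPre 𝕜 𝓕) :=
  ∑ i ∈ F, θ i • coordL h𝓕 i

theorem comb_apply (h𝓕 : ∀ i : ℕ+, {i} ∈ 𝓕) (F : Finset ℕ+) (θ : ℕ+ → 𝕜) (x : CombPre 𝕜 𝓕) :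
    comb h𝓕 F θ x = ∑ i ∈ F, θ i * coord i x := by
  simp [comb, coordL_apply]

theorem comb_unit (h𝓕 : ∀ i : ℕ+, {i} ∈ 𝓕) (F : Finset ℕ+) (θ : ℕ+ → 𝕜) (j : ℕ+) :
    comb h𝓕 F θ (unit 𝕜 𝓕 j) = if j ∈ F then θ j else 0 := by
  simp [comb_apply, coord_unit]

theorem comb_eq_of_support {h𝓕 : ∀ i : ℕ+, {i} ∈ 𝓕} {F : Finset ℕ+}
    {f : StrongDual 𝕜 (CombPre 𝕜 𝓕)} (hf : ∀ j ∉ F, f (unit 𝕜 𝓕 j) = 0) :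
    f = comb h𝓕 F fun j => f (unit 𝕜 𝓕 j) := by
  refine dual_ext fun j => ?_
  rw [comb_unit]
  split_ifs with h
  · rfl
  · exact hf j h

theorem norm_comb_le (h𝓕 : ∀ i : ℕ+, {i} ∈ 𝓕) {F : Finset ℕ+} (hF : F ∈ 𝓕) {θ : ℕ+ → 𝕜}
    (hθ : ∀ i, ‖θ i‖ = 1) : ‖comb h𝓕 F θ‖ ≤ 1 := by
  refine ContinuousLinearMap.opNorm_le_bound _ zero_le_one fun x => ?_
  rw [comb_apply, one_mul]
  refine (norm_sum_le _ _).trans (le_trans (le_of_eq ?_) (sum_le_norm x hF))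
  exact Finset.sum_congr rfl fun i _ => by rw [norm_mul, hθ, one_mul]

theorem apply_vec (f : StrongDual 𝕜 (CombPre 𝕜 𝓕)) (B : Finset ℕ+) (c : ℕ+ → 𝕜) :
    f (vec 𝓕 B c) = ∑ i ∈ B, c i * f (unit 𝕜 𝓕 i) := by
  simp [vec, map_sum]

/-- If `F` is a maximal member of `𝓕`, the functionals `∑_{i ∈ F} θ_i e_i^*` with unimodular
`θ_i` are extreme. -/
theorem isExtremeInBall_comb (h𝓕 : ∀ i : ℕ+, {i} ∈ 𝓕) (hsub : ∀ F ∈ 𝓕, ∀ G ⊆ F, G ∈ 𝓕)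
    {F : Finset ℕ+} (hF : F ∈ 𝓕) (hmax : ∀ x, insert x F ∈ 𝓕 → x ∈ F) {θ : ℕ+ → 𝕜}
    (hθ : ∀ i, ‖θ i‖ = 1) : IsExtremeInBall (comb h𝓕 F θ) := by
  have h0 : ∅ ∈ 𝓕 := hsub F hF _ (Finset.empty_subset _)
  refine ⟨norm_comb_le h𝓕 hF hθ, fun g hadd hsubt => ?_⟩
  have hin : ∀ i ∈ F, g (unit 𝕜 𝓕 i) = 0 := by
    intro i hi
    have h1 : ‖θ i + g (unit 𝕜 𝓕 i)‖ ≤ 1 := by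
      have := (comb h𝓕 F θ + g).le_of_opNorm_le_of_le hadd (norm_unit_le i)
      rwa [add_apply, comb_unit, if_pos hi, one_mul] at this
    have h2 : ‖θ i - g (unit 𝕜 𝓕 i)‖ ≤ 1 := by
      have := (comb h𝓕 F θ - g).le_of_opNorm_le_of_le hsubt (norm_unit_le i)
      rwa [sub_apply, comb_unit, if_pos hi, one_mul] at this
    have h3 := parallelogram_law_with_norm 𝕜 (θ i) (g (unit 𝕜 𝓕 i))
    rw [hθ] at h3
    have h4 := mul_le_one₀ h1 (norm_nonneg _) h1
    have h5 := mul_le_one₀ h2 (norm_nonneg _) h2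
    have h6 : ‖g (unit 𝕜 𝓕 i)‖ * ‖g (unit 𝕜 𝓕 i)‖ ≤ 0 := by linarith
    exact norm_eq_zero.mp (mul_self_eq_zero.mp (le_antisymm h6 (mul_self_nonneg _)))
  refine dual_ext fun i => ?_
  by_cases hi : i ∈ F
  · exact hin i hi
  -- test on `∑_{k ∈ F} θ_k⁻¹ e_k + c e_i`, whose norm is at most `|F|`
  obtain ⟨c, hc, hcg⟩ := RCLike.exists_norm_eq_mul_self (g (unit 𝕜 𝓕 i))
  set t : ℕ+ → 𝕜 := fun k => if k ∈ F then (θ k)⁻¹ else c with ht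
  have htn : ∀ k ∈ insert i F, ‖t k‖ ≤ 1 := by
    intro k _
    simp only [ht]
    split_ifs
    · simp [hθ]
    · exact hc.le
  have hnorm := norm_vec_le hsub h0 (fun h => hi (hmax i h)) htn
  have hcard : ((insert i F).card : ℝ) - 1 = F.card := by
    rw [Finset.card_insert_of_notMem hi]
    push_cast
    ring
  rw [hcard] at hnorm
  have h1 := (comb h𝓕 F θ + g).le_of_opNorm_le_of_le hadd hnorm
  have h2 : (comb h𝓕 F θ + g) (vec 𝓕 (insert i F) t)
      = ((F.card + ‖g (unit 𝕜 𝓕 i)‖ : ℝ) : 𝕜) := by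
    rw [apply_vec, Finset.sum_insert hi]
    have h3 : ∑ k ∈ F, t k * (comb h𝓕 F θ + g) (unit 𝕜 𝓕 k) = F.card := by
      rw [Finset.sum_congr rfl (g := fun _ => (1 : 𝕜))]
      · simp
      · intro k hk
        have hk0 : θ k ≠ 0 := norm_ne_zero_iff.mp (by rw [hθ]; exact one_ne_zero)
        simp only [ht, if_pos hk]
        rw [add_apply, comb_unit, if_pos hk, hin k hk, add_zero, inv_mul_cancel₀ hk0]
    rw [h3, add_apply, comb_unit, if_neg hi, zero_add]
    simp only [ht, if_neg hi]
    rw [← hcg]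
    push_cast
    ring
  rw [h2, RCLike.norm_of_nonneg (by positivity), one_mul] at h1
  have h3 : ‖g (unit 𝕜 𝓕 i)‖ ≤ 0 := by linarith
  exact norm_le_zero_iff.mp h3

/-- The identity of `c₀₀`, from the norm of a family to that of a subfamily. -/
noncomputable def restrictL (h : 𝓖 ⊆ 𝓕) : CombPre 𝕜 𝓕 →L[𝕜] CombPre 𝕜 𝓖 :=
  LinearMap.mkContinuous (show CombPre 𝕜 𝓕 →ₗ[𝕜] CombPre 𝕜 𝓖 from
    (LinearMap.id : (ℕ+ →₀ 𝕜) →ₗ[𝕜] (ℕ+ →₀ 𝕜))) 1 fun x => by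
      rw [one_mul]
      exact norm_le (norm_nonneg x) fun F hF => sum_le_norm x (h hF)

theorem coord_restrictL (h : 𝓖 ⊆ 𝓕) (i : ℕ+) (x : CombPre 𝕜 𝓕) :
    coord i (restrictL h x) = coord i x := rfl

theorem norm_comp_restrictL_le (h : 𝓖 ⊆ 𝓕) (f : StrongDual 𝕜 (CombPre 𝕜 𝓖)) :
    ‖f.comp (restrictL h)‖ ≤ ‖f‖ :=
  (f.opNorm_comp_le _).trans (mul_le_of_le_one_right (norm_nonneg _)
    (LinearMap.mkContinuous_norm_le _ zero_le_one _))

/-- If `𝓕 ⊆ 𝓖₀ ∪ 𝓖₁`, then the norm of `𝓕` is at most the maximum of the norms of `𝓖₀` and `𝓖₁`,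
and by Hahn–Banach a functional splits with additive norms. -/
theorem exists_split {𝓖₀ 𝓖₁ : Set (Finset ℕ+)} (h₀ : 𝓖₀ ⊆ 𝓕) (h₁ : 𝓖₁ ⊆ 𝓕)
    (hu : 𝓕 ⊆ 𝓖₀ ∪ 𝓖₁) (f : StrongDual 𝕜 (CombPre 𝕜 𝓕)) :
    ∃ (f₀ : StrongDual 𝕜 (CombPre 𝕜 𝓖₀)) (f₁ : StrongDual 𝕜 (CombPre 𝕜 𝓖₁)),
      f = f₀.comp (restrictL h₀) + f₁.comp (restrictL h₁) ∧ ‖f₀‖ + ‖f₁‖ ≤ ‖f‖ := by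
  set ι : CombPre 𝕜 𝓕 →ₗ[𝕜] CombPre 𝕜 𝓖₀ × CombPre 𝕜 𝓖₁ :=
    ((restrictL h₀).prod (restrictL h₁)).toLinearMap with hι
  have hinj : Function.Injective ι := fun x y hxy => congrArg Prod.fst hxy
  have hnorm : ∀ x, ‖x‖ ≤ ‖ι x‖ := fun x => by
    refine norm_le (norm_nonneg _) fun F hF => ?_
    rcases hu hF with h | h
    · exact (sum_le_norm (restrictL h₀ x) h).trans (norm_fst_le (ι x))
    · exact (sum_le_norm (restrictL h₁ x) h).trans (norm_snd_le (ι x))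
  set e := LinearEquiv.ofInjective ι hinj with he
  obtain ⟨Φ, hΦ, hΦn⟩ := exists_extension_norm_eq (LinearMap.range ι)
    ((f.toLinearMap ∘ₗ e.symm.toLinearMap).mkContinuous ‖f‖ fun y => by
      have h1 : ι (e.symm y) = y := congrArg Subtype.val (e.apply_symm_apply y)
      refine (f.le_opNorm (e.symm y)).trans (mul_le_mul_of_nonneg_left ?_ (norm_nonneg _))
      refine (hnorm _).trans (le_of_eq ?_)
      rw [h1]
      rfl)
  have hΦf : ∀ x, Φ (ι x) = f x := fun x => by
    have := hΦ (e x)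
    simpa [he] using this
  refine ⟨Φ.comp (ContinuousLinearMap.inl 𝕜 _ _), Φ.comp (ContinuousLinearMap.inr 𝕜 _ _), ?_, ?_⟩
  · ext x
    rw [← hΦf x]
    simp only [add_apply, ContinuousLinearMap.comp_apply]
    rw [← map_add]
    congr 1
    simp [hι]
  · refine (norm_add_norm_le_of_prod (Φ := Φ) fun x y => ?_).trans ?_
    · simp only [ContinuousLinearMap.comp_apply]
      rw [← map_add]
      simp
    rw [hΦn]
    exact LinearMap.mkContinuous_norm_le _ (norm_nonneg _) _

/-- The coordinates of an extreme functional are `0` or unimodular. The norm is the maximum of its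
parts given by the members of `𝓕` that avoid `j` and those that contain `j`; an extreme functional
lives on one part, and on the second part its `j`-th coordinate can be varied freely in the unit
disc. -/
theorem _root_.IsExtremeInBall.apply_unit (h𝓕 : ∀ i : ℕ+, {i} ∈ 𝓕)
    {f : StrongDual 𝕜 (CombPre 𝕜 𝓕)} (hf : IsExtremeInBall f) (j : ℕ+) :
    f (unit 𝕜 𝓕 j) = 0 ∨ ‖f (unit 𝕜 𝓕 j)‖ = 1 := by
  have h₀ : {F ∈ 𝓕 | j ∉ F} ⊆ 𝓕 := fun F hF => hF.1
  have h₁ : {F ∈ 𝓕 | j ∈ F} ⊆ 𝓕 := fun F hF => hF.1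
  obtain ⟨f₀, f₁, hsplit, hle⟩ := exists_split h₀ h₁
    (fun F hF => (em (j ∈ F)).elim (fun h => Or.inr ⟨hF, h⟩) fun h => Or.inl ⟨hF, h⟩) f
  set F₀ := f₀.comp (restrictL h₀) with hF₀
  set F₁ := f₁.comp (restrictL h₁) with hF₁
  set a := ‖f₀‖ with ha
  set b := ‖f₁‖ with hb
  have hab : a + b ≤ 1 := hle.trans hf.1
  have ha0 : 0 ≤ a := norm_nonneg _
  have hb0 : 0 ≤ b := norm_nonneg _
  have hF₀n : ‖F₀‖ ≤ a := norm_comp_restrictL_le h₀ f₀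
  have hF₁n : ‖F₁‖ ≤ b := norm_comp_restrictL_le h₁ f₁
  have hbound : ∀ s t : ℝ, 0 ≤ s → 0 ≤ t → s * a + t * b ≤ 1 →
      ‖(s : 𝕜) • F₀ + (t : 𝕜) • F₁‖ ≤ 1 := fun s t hs ht hst => by
    refine (norm_add_le _ _).trans (le_trans ?_ hst)
    rw [norm_smul, norm_smul, RCLike.norm_of_nonneg hs, RCLike.norm_of_nonneg ht]
    exact add_le_add (mul_le_mul_of_nonneg_left hF₀n hs) (mul_le_mul_of_nonneg_left hF₁n ht)
  have hF₀j : F₀ (unit 𝕜 𝓕 j) = 0 := by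
    have h1 : ‖restrictL h₀ (unit 𝕜 𝓕 j)‖ ≤ 0 := norm_le le_rfl fun F hF => by
      refine (Finset.sum_eq_zero fun i hi => ?_).le
      rw [coord_restrictL, coord_unit, if_neg (fun h : j = i => hF.2 (h ▸ hi)),
        norm_zero]
    refine norm_le_zero_iff.mp ((f₀.le_opNorm _).trans ?_)
    exact mul_nonpos_of_nonneg_of_nonpos (norm_nonneg _) h1
  -- shifting mass between the two parts keeps the total norm at most `a + b ≤ 1`
  have hg := hf.2 ((b : 𝕜) • F₀ - (a : 𝕜) • F₁) (by
      have := hbound (1 + b) (1 - a) (by linarith) (by linarith) (by linarith)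
      have heq : f + ((b : 𝕜) • F₀ - (a : 𝕜) • F₁)
          = ((1 + b : ℝ) : 𝕜) • F₀ + ((1 - a : ℝ) : 𝕜) • F₁ := by
        rw [hsplit]
        push_cast
        module
      rw [heq]
      exact this) (by
      have := hbound (1 - b) (1 + a) (by linarith) (by linarith) (by linarith)
      have heq : f - ((b : 𝕜) • F₀ - (a : 𝕜) • F₁)
          = ((1 - b : ℝ) : 𝕜) • F₀ + ((1 + a : ℝ) : 𝕜) • F₁ := by
        rw [hsplit]
        push_cast
        module
      rw [heq]
      exact this)
  have hprod : (a : 𝕜) * f (unit 𝕜 𝓕 j) = 0 := by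
    have h1 := congrArg (fun g : StrongDual 𝕜 (CombPre 𝕜 𝓕) => g (unit 𝕜 𝓕 j)) hg
    simp only [sub_apply, smul_apply, hF₀j, smul_eq_mul, mul_zero, zero_sub, zero_apply] at h1
    rw [hsplit, add_apply, hF₀j, zero_add]
    exact neg_eq_zero.mp h1
  refine (mul_eq_zero.mp hprod).symm.imp_right fun ha' => ?_
  have ha'' : a = 0 := by exact_mod_cast ha'
  have hfF₁ : f = F₁ := by
    refine ContinuousLinearMap.ext fun x => ?_
    have h0 : F₀ x = 0 := by
      simpa using F₀.le_of_opNorm_le (hF₀n.trans ha''.le) x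
    rw [hsplit, add_apply, h0, zero_add]
  have hb1 : b ≤ 1 := by linarith
  set lam := f (unit 𝕜 𝓕 j) with hlam
  have hlam1 : ‖lam‖ ≤ 1 := by simpa using f.le_of_opNorm_le_of_le hf.1 (norm_unit_le j)
  -- `f` is controlled by the members containing `j`, so `lam` can move freely in the unit disc
  have hvary : ∀ μ : 𝕜, ‖lam + μ‖ ≤ 1 → ‖f + μ • coordL h𝓕 j‖ ≤ 1 := by
    intro μ hμ
    refine ContinuousLinearMap.opNorm_le_bound _ zero_le_one fun x => ?_
    set y := x - coord j x • unit 𝕜 𝓕 j with hy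
    have hxy : x = y + coord j x • unit 𝕜 𝓕 j := by rw [hy]; abel
    have hyn : ‖restrictL h₁ y‖ ≤ ‖x‖ - ‖coord j x‖ := by
      have hj : ‖coord j x‖ ≤ ‖x‖ := by simpa using sum_le_norm x (h𝓕 j)
      refine norm_le (by linarith) fun F hF => ?_
      have h1 := sum_le_norm x hF.1
      rw [← Finset.add_sum_erase _ _ hF.2] at h1 ⊢
      have h2 : ∑ i ∈ F.erase j, ‖coord i (restrictL h₁ y)‖ = ∑ i ∈ F.erase j, ‖coord i x‖ := by
        refine Finset.sum_congr rfl fun i hi => ?_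
        rw [coord_restrictL, hy, map_sub, map_smul, coord_unit,
          if_neg (Finset.ne_of_mem_erase hi).symm, smul_zero, sub_zero]
      have h3 : coord j (restrictL h₁ y) = 0 := by
        rw [coord_restrictL, hy, map_sub, map_smul, coord_unit, if_pos rfl, smul_eq_mul, mul_one,
          sub_self]
      rw [h2, h3, norm_zero]
      linarith
    have hfy : ‖f y‖ ≤ ‖x‖ - ‖coord j x‖ := by
      rw [hfF₁]
      refine (f₁.le_of_opNorm_le hb1 _).trans ?_
      rwa [one_mul]
    have hval : (f + μ • coordL h𝓕 j : StrongDual 𝕜 (CombPre 𝕜 𝓕)) x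
        = f y + (lam + μ) * coord j x := by
      rw [add_apply, smul_apply, coordL_apply]
      conv_lhs => rw [hxy]
      rw [map_add, map_smul, ← hxy, ← hlam, smul_eq_mul, smul_eq_mul]
      ring
    rw [hval, one_mul]
    refine (norm_add_le _ _).trans ?_
    have := mul_le_mul_of_nonneg_right hμ (norm_nonneg (coord j x))
    rw [norm_mul]
    linarith
  have hμ : ‖((1 - ‖lam‖ : ℝ) : 𝕜)‖ = 1 - ‖lam‖ := RCLike.norm_of_nonneg (by linarith)
  have h0 := hf.2 (((1 - ‖lam‖ : ℝ) : 𝕜) • coordL h𝓕 j)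
    (hvary _ ((norm_add_le _ _).trans (by rw [hμ]; linarith)))
    (by
      have heq : f - ((1 - ‖lam‖ : ℝ) : 𝕜) • coordL h𝓕 j
          = f + (-((1 - ‖lam‖ : ℝ) : 𝕜)) • coordL h𝓕 j := by
        module
      rw [heq]
      exact hvary _ ((norm_add_le _ _).trans (by rw [norm_neg, hμ]; linarith)))
  have h1 := congrArg (fun g : StrongDual 𝕜 (CombPre 𝕜 𝓕) => g (unit 𝕜 𝓕 j)) h0
  simp only [smul_apply, coordL_apply, coord_unit, if_true, smul_eq_mul, mul_one,
    zero_apply] at h1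
  rw [h1, norm_zero] at hμ
  linarith

/-- A functional in the unit ball with unimodular coordinates on `B` forces `B ∈ 𝓕`. -/
theorem mem_of_norm_apply_unit (hsub : ∀ F ∈ 𝓕, ∀ G ⊆ F, G ∈ 𝓕) (h0 : ∅ ∈ 𝓕)
    {f : StrongDual 𝕜 (CombPre 𝕜 𝓕)} (hf : ‖f‖ ≤ 1) {B : Finset ℕ+}
    (hB : ∀ j ∈ B, ‖f (unit 𝕜 𝓕 j)‖ = 1) : B ∈ 𝓕 := by
  by_contra hB'
  have h1 := norm_vec_le (c := fun j => (f (unit 𝕜 𝓕 j))⁻¹) hsub h0 hB'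
    fun i hi => by simp [hB i hi]
  have h2 := f.le_of_opNorm_le_of_le hf h1
  rw [apply_vec, Finset.sum_congr rfl (g := fun _ => (1 : 𝕜))] at h2
  · simp at h2
    linarith
  · intro j hj
    exact inv_mul_cancel₀ (norm_ne_zero_iff.mp (by rw [hB j hj]; exact one_ne_zero))

/-- The support of an extreme functional is a member of `𝓕`. -/
theorem _root_.IsExtremeInBall.exists_support (hS : IsRegularFamily 𝓕) (h𝓕 : ∀ i : ℕ+, {i} ∈ 𝓕)
    {f : StrongDual 𝕜 (CombPre 𝕜 𝓕)} (hf : IsExtremeInBall f) :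
    ∃ F ∈ 𝓕, ∀ j, j ∈ F ↔ f (unit 𝕜 𝓕 j) ≠ 0 := by
  have hmem : ∀ B : Finset ℕ+, ↑B ⊆ {j | f (unit 𝕜 𝓕 j) ≠ 0} → B ∈ 𝓕 := fun B hB =>
    mem_of_norm_apply_unit (fun F hF G hG => hS.mono hF hG) hS.empty_mem hf.1 fun j hj =>
      (hf.apply_unit h𝓕 j).resolve_left (hB hj)
  have hfin : {j | f (unit 𝕜 𝓕 j) ≠ 0}.Finite := by
    by_contra hinf
    obtain ⟨F, hFA, hF⟩ := hS.compact hinf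
    exact hF (hmem F hFA)
  exact ⟨hfin.toFinset, hmem _ (by simp), fun j => by simp⟩

end CombPre

/-! ### Isometries of the dual -/

/-- If all sums `∑ θ_i c_i` with unimodular `θ_i` have modulus `0` or `1` and some `c_i ≠ 0`, then
`∑ |c_i| = 1` and `|c_k| ∈ {0, 1/2, 1}`. (The value `1/2` does occur for real scalars.) -/
theorem sum_norm_eq_one_of_unimodular_sums {𝕜 ι : Type*} [RCLike 𝕜] {F : Finset ι} {c : ι → 𝕜}
    (h : ∀ θ : ι → 𝕜, (∀ i, ‖θ i‖ = 1) → ∑ i ∈ F, θ i * c i = 0 ∨ ‖∑ i ∈ F, θ i * c i‖ = 1)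
    {i : ι} (hi : i ∈ F) (hci : c i ≠ 0) :
    ∑ k ∈ F, ‖c k‖ = 1 ∧ ∀ k ∈ F, c k = 0 ∨ ‖c k‖ = 1 / 2 ∨ ‖c k‖ = 1 := by
  classical
  choose φ hφ hφc using fun k => RCLike.exists_norm_eq_mul_self (c k)
  have hsum : ∑ k ∈ F, φ k * c k = ((∑ k ∈ F, ‖c k‖ : ℝ) : 𝕜) := by
    rw [RCLike.ofReal_sum]
    exact Finset.sum_congr rfl fun k _ => (hφc k).symm
  have hpos : 0 < ∑ k ∈ F, ‖c k‖ :=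
    (norm_pos_iff.mpr hci).trans_le
      (Finset.single_le_sum (f := fun k => ‖c k‖) (fun _ _ => norm_nonneg _) hi)
  have h1 : ∑ k ∈ F, ‖c k‖ = 1 := by
    have := h φ hφ
    rw [hsum, RCLike.norm_of_nonneg hpos.le] at this
    exact this.resolve_left (by exact_mod_cast hpos.ne')
  refine ⟨h1, fun k hk => ?_⟩
  -- change the sign of the phase at `k`
  have h2 : ∑ l ∈ F, Function.update φ k (-φ k) l * c l = ((1 - 2 * ‖c k‖ : ℝ) : 𝕜) := by
    rw [← Finset.add_sum_erase _ _ hk, h1] at hsum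
    rw [← Finset.add_sum_erase _ _ hk, Function.update_self]
    rw [Finset.sum_congr rfl (g := fun l => φ l * c l) fun l hl => by
      rw [Function.update_of_ne (Finset.ne_of_mem_erase hl)]]
    push_cast at hsum ⊢
    linear_combination hsum + 2 * hφc k
  have h3 := h (Function.update φ k (-φ k)) fun l => by
    rcases eq_or_ne l k with rfl | hl
    · rw [Function.update_self, norm_neg, hφ]
    · rw [Function.update_of_ne hl, hφ]
  rw [h2] at h3
  rcases h3 with h3 | h3
  · have h4 : 1 - 2 * ‖c k‖ = 0 := by exact_mod_cast h3
    exact Or.inr (Or.inl (by linarith))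
  · rw [RCLike.norm_ofReal] at h3
    rcases (abs_eq zero_le_one).mp h3 with h4 | h4
    · exact Or.inl (norm_eq_zero.mp (by linarith))
    · exact Or.inr (Or.inr (by linarith))

namespace CombPre

variable {𝕜 : Type*} [RCLike 𝕜] {S : Set (Finset ℕ+)} {h𝓕 : ∀ i : ℕ+, {i} ∈ S}

theorem map_comb_apply (T : StrongDual 𝕜 (CombPre 𝕜 S) ≃ₗᵢ[𝕜] StrongDual 𝕜 (CombPre 𝕜 S))
    (F : Finset ℕ+) (θ : ℕ+ → 𝕜) (x : CombPre 𝕜 S) :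
    T (comb h𝓕 F θ) x = ∑ i ∈ F, θ i * T (coordL h𝓕 i) x := by
  simp [comb, map_sum]

theorem coordL_unit (i j : ℕ+) : coordL (𝕜 := 𝕜) h𝓕 i (unit 𝕜 S j) = if j = i then 1 else 0 :=
  coord_unit j i

theorem comb_singleton (i : ℕ+) (θ : ℕ+ → 𝕜) : comb h𝓕 {i} θ = θ i • coordL h𝓕 i := by
  simp [comb]

section

variable (hS : IsRegularFamily S)
  (T : StrongDual 𝕜 (CombPre 𝕜 S) ≃ₗᵢ[𝕜] StrongDual 𝕜 (CombPre 𝕜 S))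

include hS

theorem isExtremeInBall_map_comb {F : Finset ℕ+} (hF : F ∈ S)
    (hmax : ∀ x, insert x F ∈ S → x ∈ F) {θ : ℕ+ → 𝕜} (hθ : ∀ i, ‖θ i‖ = 1) :
    IsExtremeInBall (T (comb h𝓕 F θ)) :=
  (isExtremeInBall_comb h𝓕 (fun _ hF _ hG => hS.mono hF hG) hF hmax hθ).map T

theorem singleton_one_maximal (x : ℕ+) (hx : insert x {1} ∈ S) : x ∈ ({1} : Finset ℕ+) := by
  rw [← hS.eq_singleton_one hx (by simp)]
  exact Finset.mem_insert_self _ _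

/-- For a maximal `F` the moduli of the `j`-th coordinates of `T e_i^*`, `i ∈ F`, are all `0`, or
they lie in `{0, 1/2, 1}` and add up to `1`. -/
theorem sum_norm_map_coordL {F : Finset ℕ+} (hF : F ∈ S) (hmax : ∀ x, insert x F ∈ S → x ∈ F)
    {i j : ℕ+} (hi : i ∈ F) (hij : T (coordL h𝓕 i) (unit 𝕜 S j) ≠ 0) :
    ∑ k ∈ F, ‖T (coordL h𝓕 k) (unit 𝕜 S j)‖ = 1 ∧
      ∀ k ∈ F, T (coordL h𝓕 k) (unit 𝕜 S j) = 0 ∨ ‖T (coordL h𝓕 k) (unit 𝕜 S j)‖ = 1 / 2 ∨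
        ‖T (coordL h𝓕 k) (unit 𝕜 S j)‖ = 1 := by
  refine sum_norm_eq_one_of_unimodular_sums (fun θ hθ => ?_) hi hij
  rw [← map_comb_apply]
  exact (isExtremeInBall_map_comb hS T hF hmax hθ).apply_unit h𝓕 j

/-- For `p ≠ 1` the functional `T e_p^*` vanishes at `e_1`. Otherwise every maximal `F ∋ p` would
carry an extreme functional mapped by `T` to a multiple of `e_1^*`, because `{1}` is the only member
containing `1`; so all these `F` would be the support of `T⁻¹ e_1^*`. -/
theorem map_coordL_unit_one {p : ℕ+} (hp : p ≠ 1) : T (coordL h𝓕 p) (unit 𝕜 S 1) = 0 := by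
  by_contra hne
  have hsupp : ∀ F ∈ S, (∀ x, insert x F ∈ S → x ∈ F) → p ∈ F →
      ∀ j, j ∈ F ↔ T.symm (coordL h𝓕 1) (unit 𝕜 S j) ≠ 0 := by
    intro F hF hmax hpF j
    -- phases `φ` for which all summands of the first coordinate are nonnegative
    choose φ hφ hφc using fun k => RCLike.exists_norm_eq_mul_self (T (coordL h𝓕 k) (unit 𝕜 S 1))
    obtain ⟨G, hG, hGT⟩ :=
      (isExtremeInBall_map_comb (h𝓕 := h𝓕) hS T hF hmax hφ).exists_support hS h𝓕
    have h1 : T (comb h𝓕 F φ) (unit 𝕜 S 1) ≠ 0 := by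
      rw [map_comb_apply, Finset.sum_congr rfl fun k _ => (hφc k).symm, ← RCLike.ofReal_sum,
        (sum_norm_map_coordL hS T hF hmax hpF hne).1]
      simp
    have hG1 := hS.eq_singleton_one hG ((hGT 1).mpr h1)
    have h2 : T (comb h𝓕 F φ) = T (comb h𝓕 F φ) (unit 𝕜 S 1) • coordL h𝓕 1 := by
      rw [← comb_singleton (θ := fun i => T (comb h𝓕 F φ) (unit 𝕜 S i))]
      refine comb_eq_of_support fun j hj => ?_
      by_contra h
      exact hj (hG1 ▸ (hGT j).mpr h)
    have h3 : comb h𝓕 F φ = T (comb h𝓕 F φ) (unit 𝕜 S 1) • T.symm (coordL h𝓕 1) := by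
      rw [← map_smul, ← h2, T.symm_apply_apply]
    have h4 := congrArg (fun f : StrongDual 𝕜 (CombPre 𝕜 S) => f (unit 𝕜 S j)) h3
    simp only [smul_apply, smul_eq_mul, comb_unit] at h4
    constructor
    · intro hj h0
      rw [if_pos hj, h0, mul_zero] at h4
      have := hφ j
      rw [h4, norm_zero] at this
      exact zero_ne_one this
    · intro h0
      by_contra hj
      rw [if_neg hj] at h4
      exact (mul_ne_zero h1 h0) h4.symm
  obtain ⟨F, hF, hpF, -, hmax⟩ := hS.exists_maximal (h𝓕 p) Set.infinite_univ
  obtain ⟨m, hm⟩ := Infinite.exists_notMem_finset (insert 1 F)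
  rw [Finset.mem_insert, not_or] at hm
  obtain ⟨F', hF', hpF', -, hmax'⟩ := hS.exists_maximal (hS.pair_mem hp hm.1) Set.infinite_univ
  refine hm.2 ((hsupp F hF hmax (hpF (by simp)) m).mpr ?_)
  exact (hsupp F' hF' hmax' (hpF' (by simp)) m).mp (hpF' (by simp))

/-- Hence `T e_1^*` is a multiple of `e_1^*`: the extreme functional `T⁻¹ e_1^*` has `1` in its
support, which is therefore `{1}`. -/
theorem map_coordL_one_unit {j : ℕ+} (hj : j ≠ 1) : T (coordL h𝓕 1) (unit 𝕜 S j) = 0 := by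
  have hext : IsExtremeInBall (T.symm (coordL h𝓕 1)) := by
    have := isExtremeInBall_map_comb (h𝓕 := h𝓕) (θ := fun _ => (1 : 𝕜)) hS T.symm (h𝓕 1)
      (singleton_one_maximal hS) fun _ => norm_one
    rwa [comb_singleton, one_smul] at this
  obtain ⟨A, hA, hAT⟩ := hext.exists_support hS h𝓕
  set θ : ℕ+ → 𝕜 := fun i => T.symm (coordL h𝓕 1) (unit 𝕜 S i) with hθ
  have hcomb : T.symm (coordL h𝓕 1) = comb h𝓕 A θ := by
    refine comb_eq_of_support fun i hi => ?_
    by_contra h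
    exact hi ((hAT i).mpr h)
  have hT : coordL h𝓕 1 = T (comb h𝓕 A θ) := by rw [← hcomb, T.apply_symm_apply]
  have h1A : 1 ∈ A := by
    by_contra h1
    have h2 := congrArg (fun f : StrongDual 𝕜 (CombPre 𝕜 S) => f (unit 𝕜 S 1)) hT
    simp only [coordL_unit, if_true, map_comb_apply] at h2
    rw [Finset.sum_eq_zero fun i hi => by
      rw [map_coordL_unit_one hS T fun h => h1 (h ▸ hi), mul_zero]] at h2
    exact one_ne_zero h2
  have h2 := congrArg (fun f : StrongDual 𝕜 (CombPre 𝕜 S) => f (unit 𝕜 S j)) hT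
  simp only [coordL_unit, if_neg hj, hS.eq_singleton_one hA h1A, map_comb_apply,
    Finset.sum_singleton] at h2
  exact (mul_eq_zero.mp h2.symm).resolve_left ((hAT 1).mp h1A)

/-- The coordinates of `T e_i^*` are `0` or unimodular: a maximal `F ∋ i` can be chosen to avoid the
other `k` with `(T e_k^*)(e_j) ≠ 0`, because there are only finitely many. -/
theorem norm_map_coordL_unit {i j : ℕ+} (hij : T (coordL h𝓕 i) (unit 𝕜 S j) ≠ 0) :
    ‖T (coordL h𝓕 i) (unit 𝕜 S j)‖ = 1 := by
  rcases eq_or_ne i 1 with rfl | hi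
  · simpa using (sum_norm_map_coordL hS T (h𝓕 1) (singleton_one_maximal hS)
      (Finset.mem_singleton_self 1) hij).1
  have hfin : {k : ℕ+ | T (coordL h𝓕 k) (unit 𝕜 S j) ≠ 0}.Finite := by
    by_contra hinf
    -- three points of the set, all at least `3`, lie in a member
    have hinf' : ({k : ℕ+ | T (coordL h𝓕 k) (unit 𝕜 S j) ≠ 0} \ Set.Iio 3).Infinite :=
      Set.Infinite.sdiff hinf (Set.finite_Iio 3)
    obtain ⟨B, hB, hB3⟩ := hinf'.exists_subset_card_eq 3
    have hBS : B ∈ S := hS.schreier_subset fun x hx => by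
      have h3 : (3 : ℕ+) ≤ x := not_lt.mp (hB hx).2
      rw [hB3]
      exact_mod_cast h3
    obtain ⟨F, hF, hBF, -, hmax⟩ := hS.exists_maximal hBS Set.infinite_univ
    obtain ⟨b, hb⟩ : B.Nonempty := Finset.card_pos.mp (by omega)
    obtain ⟨h1, h2⟩ := sum_norm_map_coordL hS T hF hmax (hBF hb) (hB hb).1
    have h3 : ∑ k ∈ B, (1 / 2 : ℝ) ≤ ∑ k ∈ F, ‖T (coordL h𝓕 k) (unit 𝕜 S j)‖ := by
      refine (Finset.sum_le_sum fun k hk => ?_).trans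
        (Finset.sum_le_sum_of_subset_of_nonneg hBF fun _ _ _ => norm_nonneg _)
      rcases (h2 k (hBF hk)).resolve_left (hB hk).1 with h | h <;> rw [h]
      norm_num
    rw [h1, Finset.sum_const, hB3] at h3
    norm_num at h3
  obtain ⟨F, hF, hiF, hFN, hmax⟩ := hS.exists_maximal (h𝓕 i) hfin.infinite_compl
  have h1 := (sum_norm_map_coordL hS T hF hmax (hiF (Finset.mem_singleton_self i)) hij).1
  rwa [Finset.sum_eq_single_of_mem i (hiF (Finset.mem_singleton_self i)) fun k hk hki => ?_] at h1
  have hk' := (hFN hk).resolve_left (by simpa using hki)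
  rw [norm_eq_zero]
  simpa using hk'

/-- The functionals `T e_i^*` have pairwise disjoint supports. -/
theorem map_coordL_disjoint {i k j : ℕ+} (hi : T (coordL h𝓕 i) (unit 𝕜 S j) ≠ 0)
    (hk : T (coordL h𝓕 k) (unit 𝕜 S j) ≠ 0) : i = k := by
  have hone : ∀ {l : ℕ+}, T (coordL h𝓕 1) (unit 𝕜 S j) ≠ 0 →
      T (coordL h𝓕 l) (unit 𝕜 S j) ≠ 0 → l = 1 := by
    intro l h1 hl
    by_contra hne
    rcases eq_or_ne j 1 with rfl | hj
    · exact hl (map_coordL_unit_one hS T hne)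
    · exact h1 (map_coordL_one_unit hS T hj)
  by_contra hik
  rcases eq_or_ne i 1 with rfl | hi1
  · exact hik (hone hi hk).symm
  rcases eq_or_ne k 1 with rfl | hk1
  · exact hik (hone hk hi)
  obtain ⟨F, hF, hsub, -, hmax⟩ := hS.exists_maximal (hS.pair_mem hi1 hk1) Set.infinite_univ
  have h1 := (sum_norm_map_coordL hS T hF hmax (hsub (by simp : i ∈ _)) hi).1
  have h2 := Finset.sum_le_sum_of_subset_of_nonneg hsub
    fun l _ _ => norm_nonneg (T (coordL h𝓕 l) (unit 𝕜 S j))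
  rw [h1, Finset.sum_pair hik, norm_map_coordL_unit hS T hi, norm_map_coordL_unit hS T hk] at h2
  norm_num at h2

/-- `T e_i^*` is a unimodular multiple of some `e_k^*`. Its support is finite, and expanding
`e_i^* = T⁻¹ (T e_i^*)` along this support, the disjointness of the supports of the `T⁻¹ e_k^*`
leaves only one `k`. -/
theorem exists_map_coordL_eq (i : ℕ+) :
    ∃ (k : ℕ+) (t : 𝕜), ‖t‖ = 1 ∧ T (coordL h𝓕 i) = t • coordL h𝓕 k := by
  obtain ⟨F, hF, hiF, -, hmax⟩ := hS.exists_maximal (h𝓕 i) Set.infinite_univ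
  replace hiF := hiF (Finset.mem_singleton_self i)
  obtain ⟨B, -, hBT⟩ := (isExtremeInBall_map_comb (h𝓕 := h𝓕) (θ := fun _ => (1 : 𝕜)) hS T hF hmax
    fun _ => norm_one).exists_support hS h𝓕
  have hB : ∀ j ∉ B, T (coordL h𝓕 i) (unit 𝕜 S j) = 0 := by
    intro j hj
    by_contra hij
    refine hj ((hBT j).mpr ?_)
    rw [map_comb_apply, Finset.sum_eq_single_of_mem i hiF fun k _ hki => ?_, one_mul]
    · exact hij
    · rw [one_mul]
      by_contra hkj
      exact hki (map_coordL_disjoint hS T hkj hij)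
  set c : ℕ+ → 𝕜 := fun j => T (coordL h𝓕 i) (unit 𝕜 S j) with hc
  have hcomb : T (coordL h𝓕 i) = comb h𝓕 B c := comb_eq_of_support hB
  have hinv : coordL h𝓕 i = T.symm (comb h𝓕 B c) := by rw [← hcomb, T.symm_apply_apply]
  have hback : ∀ k, c k ≠ 0 → T.symm (coordL h𝓕 k) (unit 𝕜 S i) ≠ 0 := by
    intro k hk
    have hkB : k ∈ B := by
      by_contra h
      exact hk (hB k h)
    obtain ⟨l, hl⟩ : ∃ l, T.symm (coordL h𝓕 k) (unit 𝕜 S l) ≠ 0 := by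
      by_contra! h
      have h0 : T.symm (coordL h𝓕 k) = 0 := dual_ext h
      have h1 : coordL (𝕜 := 𝕜) h𝓕 k = 0 := by rw [← T.apply_symm_apply (coordL h𝓕 k), h0, map_zero]
      have h2 := coordL_unit (𝕜 := 𝕜) (h𝓕 := h𝓕) k k
      rw [h1, if_pos rfl] at h2
      exact zero_ne_one h2
    have h1 := congrArg (fun f : StrongDual 𝕜 (CombPre 𝕜 S) => f (unit 𝕜 S l)) hinv
    simp only [coordL_unit, map_comb_apply] at h1
    rw [Finset.sum_eq_single_of_mem k hkB fun k' _ hk' => ?_] at h1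
    · have hli : l = i := by
        by_contra hli
        rw [if_neg hli] at h1
        exact mul_ne_zero hk hl h1.symm
      rwa [← hli]
    · rw [mul_eq_zero]
      refine Or.inr ?_
      by_contra h
      exact hk' (map_coordL_disjoint hS T.symm h hl)
  obtain ⟨k, hk⟩ : ∃ k, c k ≠ 0 := by
    by_contra! h
    have h0 : T (coordL h𝓕 i) = 0 := dual_ext h
    have h1 : coordL (𝕜 := 𝕜) h𝓕 i = 0 := T.map_eq_zero_iff.mp h0
    have h2 := coordL_unit (𝕜 := 𝕜) (h𝓕 := h𝓕) i i
    rw [h1, if_pos rfl] at h2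
    exact zero_ne_one h2
  refine ⟨k, c k, norm_map_coordL_unit hS T hk, ?_⟩
  rw [← comb_singleton]
  refine comb_eq_of_support fun j hj => ?_
  by_contra hcj
  exact hj (Finset.mem_singleton.mpr
    (map_coordL_disjoint hS T.symm (hback j hcj) (hback k hk)))

/-- If `T` permutes the lines spanned by the `e_i^*`, the permutation preserves the family. -/
theorem map_mem_of_map_coordL_eq {π : Equiv.Perm ℕ+} {t : ℕ+ → 𝕜} (ht : ∀ i, ‖t i‖ = 1)
    (hT : ∀ i, T (coordL h𝓕 i) = t i • coordL h𝓕 (π i)) {F : Finset ℕ+} (hF : F ∈ S) :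
    F.map π.toEmbedding ∈ S := by
  obtain ⟨F', hF', hFF', -, hmax⟩ := hS.exists_maximal hF Set.infinite_univ
  obtain ⟨G, hG, hGT⟩ := (isExtremeInBall_map_comb (h𝓕 := h𝓕) (θ := fun _ => (1 : 𝕜)) hS T hF' hmax
    fun _ => norm_one).exists_support hS h𝓕
  refine hS.mono hG fun x hx => ?_
  obtain ⟨i, hi, rfl⟩ := Finset.mem_map.mp hx
  refine (hGT _).mpr ?_
  rw [map_comb_apply, Finset.sum_eq_single_of_mem i (hFF' hi) fun k _ hki => ?_]
  · rw [one_mul, hT, smul_apply, coordL_unit, Equiv.coe_toEmbedding, if_pos rfl, smul_eq_mul,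
      mul_one]
    exact norm_ne_zero_iff.mp (by rw [ht]; exact one_ne_zero)
  · rw [hT, smul_apply, coordL_unit, Equiv.coe_toEmbedding,
      if_neg fun h => hki (π.injective h).symm, smul_zero, mul_zero]

/-- Every surjective isometry of the dual is diagonal: the permutations given by `T` and `T⁻¹` are
inverse to each other and preserve the family, so both are the identity. -/
theorem exists_map_coordL_eq_smul :
    ∃ θ : ℕ+ → 𝕜, (∀ i, ‖θ i‖ = 1) ∧ ∀ i, T (coordL h𝓕 i) = θ i • coordL h𝓕 i := by
  have hleft : ∀ (T : StrongDual 𝕜 (CombPre 𝕜 S) ≃ₗᵢ[𝕜] StrongDual 𝕜 (CombPre 𝕜 S))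
      {σ τ : ℕ+ → ℕ+} {t s : ℕ+ → 𝕜}, (∀ i, T (coordL h𝓕 i) = t i • coordL h𝓕 (σ i)) →
      (∀ i, T.symm (coordL h𝓕 i) = s i • coordL h𝓕 (τ i)) → Function.LeftInverse τ σ := by
    intro T σ τ t s hσ hτ i
    have h1 : coordL (𝕜 := 𝕜) h𝓕 i = t i • s (σ i) • coordL h𝓕 (τ (σ i)) := by
      rw [← hτ (σ i), ← map_smul, ← hσ i, T.symm_apply_apply]
    have h2 := congrArg (fun f : StrongDual 𝕜 (CombPre 𝕜 S) => f (unit 𝕜 S i)) h1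
    simp only [smul_apply, coordL_unit, if_true] at h2
    by_contra hne
    rw [if_neg (Ne.symm hne), smul_zero, smul_zero] at h2
    exact one_ne_zero h2
  choose σ t ht hσ using exists_map_coordL_eq (h𝓕 := h𝓕) hS T
  choose τ s hs hτ using exists_map_coordL_eq (h𝓕 := h𝓕) hS T.symm
  let π : Equiv.Perm ℕ+ := ⟨σ, τ, hleft T hσ hτ, hleft T.symm hτ hσ⟩
  have hπ : ∀ i, σ i = i := hS.perm_eq_refl π fun F =>
    ⟨fun hF => by
      have := map_mem_of_map_coordL_eq (h𝓕 := h𝓕) (π := π.symm) hS T.symm hs hτ hF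
      rw [Finset.map_map] at this
      convert this using 1
      ext x
      simp,
    map_mem_of_map_coordL_eq (π := π) hS T ht hσ⟩
  exact ⟨t, ht, fun i => by rw [hσ, hπ]⟩

end

end CombPre

/-! ### The dual of the completion -/

/-- Restriction identifies the dual of the completion of `E` with the dual of `E`. -/
noncomputable def dualCompletionEquiv (𝕜 E : Type*) [RCLike 𝕜] [SeminormedAddCommGroup E]
    [NormedSpace 𝕜 E] :
    StrongDual 𝕜 (UniformSpace.Completion E) ≃ₗᵢ[𝕜] StrongDual 𝕜 E :=
  LinearIsometryEquiv.ofSurjective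
    { toFun := fun f => f.comp UniformSpace.Completion.toComplL
      map_add' := fun _ _ => rfl
      map_smul' := fun _ _ => rfl
      norm_map' := fun f => by
        refine le_antisymm (ContinuousLinearMap.opNorm_le_bound _ (norm_nonneg _) fun x => ?_)
          (ContinuousLinearMap.opNorm_le_bound _ (norm_nonneg _) fun x => ?_)
        · have := f.le_opNorm (x : UniformSpace.Completion E)
          rwa [UniformSpace.Completion.norm_coe] at this
        · induction x using UniformSpace.Completion.induction_on with
          | hp => exact isClosed_le (by fun_prop) (by fun_prop)
          | ih x =>
            rw [UniformSpace.Completion.norm_coe]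
            exact (f.comp UniformSpace.Completion.toComplL).le_opNorm x }
    fun f => ⟨f.extend UniformSpace.Completion.toComplL, ContinuousLinearMap.ext fun x =>
      ContinuousLinearMap.extend_eq f UniformSpace.Completion.denseRange_coe
        (UniformSpace.Completion.isUniformInducing_coe _) x⟩

theorem dualCompletionEquiv_dualBasisVec {𝕜 : Type*} [RCLike 𝕜] {𝓕 : Set (Finset ℕ+)}
    (h𝓕 : ∀ i : ℕ+, {i} ∈ 𝓕) (i : ℕ+) :
    dualCompletionEquiv 𝕜 (CombPre 𝕜 𝓕) (CombSpace.dualBasisVec 𝕜 h𝓕 i) =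
      CombPre.coordL h𝓕 i :=
  ContinuousLinearMap.ext fun x => CombSpace.dualBasisVec_coe h𝓕 i x

theorem mainTheorem2 {𝕜 : Type*} [RCLike 𝕜]
    (a : Ordinal.{0} → ℕ+ → Ordinal.{0}) (ha : IsLimitSystem a)
    (α : Ordinal.{0}) (h1 : 1 ≤ α) (hα : α < ω₁)
    (T : StrongDual 𝕜 (CombSpace 𝕜 (schreierFamily a α)) ≃ₗᵢ[𝕜]
      StrongDual 𝕜 (CombSpace 𝕜 (schreierFamily a α))) :
    ∃ θ : ℕ+ → 𝕜, (∀ i, ‖θ i‖ = 1) ∧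
      ∀ i, T (CombSpace.dualBasisVec 𝕜 (schreierFamily_singleton_mem ha h1 hα) i) =
        θ i • CombSpace.dualBasisVec 𝕜 (schreierFamily_singleton_mem ha h1 hα) i := by
  set R := dualCompletionEquiv 𝕜 (CombPre 𝕜 (schreierFamily a α)) with hR
  obtain ⟨θ, hθ, h⟩ := CombPre.exists_map_coordL_eq_smul
    (h𝓕 := schreierFamily_singleton_mem ha h1 hα) (isRegularFamily_schreierFamily ha h1 hα)
    ((R.symm.trans T).trans R)
  refine ⟨θ, hθ, fun i => R.injective ?_⟩
  have hi := h i
  rw [← dualCompletionEquiv_dualBasisVec, ← hR, ← map_smul] at hi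
  simpa using hi
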